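/- **Theorem (Testing in Non-Vanishing Community Probabilities).** A stochastic block model $\mathbb{SBM}(n;p,Q)$ on $k$ communities, where $p=(p_1,\dots,p_k)$ is a probability vector and $Q\in[-1,1]^{k\times k}$ is symmetric, is the random graph on $\{1,\dots,n\}$ obtained by drawing labels $x_1,\dots,x_n$ i.i.d. from $p$ and then, conditionally on the labels, joining each pair $i<j$ independently with probability $(1+Q_{x_i,x_j})/2$. Let $(p,Q)=(p^{(n)},Q^{(n)})$ be a sequence of parameters on $k=k(n)$ communities, which may depend on $n$. A sequence of functions $f_n$ of the graph *distinguishes $\mathbb{SBM}(n;p,Q)$ from $\mathbb{G}(n,1/2)$ with high probability* if, as $n\to\infty$, $$\Big|\mathbb{E}_{\mathbb{SBM}(n;p,Q)}f_n-\mathbb{E}_{\mathbb{G}(n,1/2)}f_n\Big|=\omega\Big(\max\big(\mathrm{Var}_{\mathbb{SBM}(n;p,Q)}f_n,\ \mathrm{Var}_{\mathbb{G}(n,1/2)}f_n\big)^{1/2}\Big),$$ that is, for every $C$ and all large $n$ the left side strictly exceeds $C$ times the square root on the right. A *constant-degree test* is a sequence $f_n$ of polynomials in the edge indicators $G_e\in\{0,1\}$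 whose degrees are bounded by some $D$ independent of $n$. The *signed count* of a graph $H$ without isolated vertices is $\mathsf{SC}_H(G)=\sum_{H'}\prod_{e\in E(H')}(2G_e-1)$, the sum being over all copies $H'$ of $H$ in the complete graph on $\{1,\dots,n\}$. Suppose that for some constant $c>0$ independent of $n$ all community probabilities satisfy $p^{(n)}_i\ge c$. If some constant-degree test distinguishes $\mathbb{SBM}(n;p,Q)$ from $\mathbb{G}(n,1/2)$ with high probability, then so does the signed count of one of the edge $\mathsf{Star}_1$, the wedge $\mathsf{Star}_2$ and the 4-cycle $\mathsf{Cyc}_4$. Which of the three is used may depend on the model parameters, but on nothing else: there is a map $(p,Q)\mapsto H(p,Q)\in\{\mathsf{Star}_1,\mathsf{Star}_2,\mathsf{Cyc}_4\}$ such that the sequence $\mathsf{SC}_{H(p^{(n)},Q^{(n)})}$ distinguishes the two models with high probability. In particular, a single one of the three graphs works when $(p,Q)$ does not depend on $n$. -/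

import Mathlib

namespace SBMTesting

open Finset

/-- The parameters `(p, Q)` of a stochastic block model on `k` communities: a probability vector
`p` and a symmetric matrix `Q` with entries in `[-1, 1]`. Vertices with labels `a` and `b` are
adjacent with probability `(1 + Q a b) / 2`. -/
structure SBM (k : ℕ) where
  p : Fin k → ℝ
  Q : Matrix (Fin k) (Fin k) ℝ
  p_nonneg : ∀ a, 0 ≤ p a
  p_sum : ∑ a, p a = 1
  Q_symm : Q.IsSymm
  abs_Q_le_one : ∀ a b, |Q a b| ≤ 1

/-- The potential edges of a graph on the vertex set `Fin n`: each unordered pair of distinct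
vertices is written as `(i, j)` with `i < j`. -/
abbrev Edge (n : ℕ) := {e : Fin n × Fin n // e.1 < e.2}

/-- Labelled simple graphs on `Fin n`, as points of `{0,1}^(n choose 2)`. -/
abbrev EdgeConfig (n : ℕ) := Edge n → Bool

/-- The mass function of the Erdős–Rényi law `G(n, 1/2)`: each edge is present independently with
probability `1/2`. -/
noncomputable def erdosRenyiMass (n : ℕ) (_G : EdgeConfig n) : ℝ :=
  ∏ _e : Edge n, (1 / 2 : ℝ)

/-- The mass function of `SBM(n; p, Q)`: the labels `x i` are i.i.d. with law `p`, and given the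
labels the edges are independent. -/
noncomputable def SBM.mass {k : ℕ} (M : SBM k) (n : ℕ) (G : EdgeConfig n) : ℝ :=
  ∑ x : Fin n → Fin k, (∏ i, M.p (x i)) *
    ∏ e : Edge n,
      if G e then (1 + M.Q (x e.1.1) (x e.1.2)) / 2 else (1 - M.Q (x e.1.1) (x e.1.2)) / 2

theorem erdosRenyiMass_nonneg (n : ℕ) (G : EdgeConfig n) : 0 ≤ erdosRenyiMass n G :=
  prod_nonneg fun _ _ => by norm_num

theorem sum_erdosRenyiMass (n : ℕ) : ∑ G, erdosRenyiMass n G = 1 := by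
  simp [erdosRenyiMass]

theorem SBM.mass_nonneg {k : ℕ} (M : SBM k) (n : ℕ) (G : EdgeConfig n) : 0 ≤ M.mass n G := by
  refine sum_nonneg fun x _ => mul_nonneg (prod_nonneg fun i _ => M.p_nonneg _)
    (prod_nonneg fun e _ => ?_)
  have h := abs_le.1 (M.abs_Q_le_one (x e.1.1) (x e.1.2))
  split_ifs <;> linarith [h.1, h.2]

theorem SBM.sum_mass {k : ℕ} (M : SBM k) (n : ℕ) : ∑ G, M.mass n G = 1 := by
  unfold SBM.mass
  rw [sum_comm]
  have key : ∀ x : Fin n → Fin k, (∑ G : EdgeConfig n, ∏ e : Edge n,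
      if G e then (1 + M.Q (x e.1.1) (x e.1.2)) / 2
        else (1 - M.Q (x e.1.1) (x e.1.2)) / 2) = 1 := by
    intro x
    rw [← Fintype.prod_sum (fun (e : Edge n) (b : Bool) =>
      if b then (1 + M.Q (x e.1.1) (x e.1.2)) / 2 else (1 - M.Q (x e.1.1) (x e.1.2)) / 2)]
    refine prod_eq_one fun e _ => ?_
    rw [Fintype.sum_bool]
    simp only [if_true, Bool.false_eq_true, if_false]
    ring
  simp only [← mul_sum, key, mul_one]
  rw [← Fintype.prod_sum (fun (_ : Fin n) (a : Fin k) => M.p a)]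
  simp [M.p_sum]

/-- Expectation of `f` under the mass function `μ`. -/
noncomputable def expect {n : ℕ} (μ : EdgeConfig n → ℝ) (f : EdgeConfig n → ℝ) : ℝ :=
  ∑ G, μ G * f G

/-- Variance of `f` under the mass function `μ`. -/
noncomputable def var {n : ℕ} (μ : EdgeConfig n → ℝ) (f : EdgeConfig n → ℝ) : ℝ :=
  expect μ fun G => (f G - expect μ f) ^ 2

/-- `f` is a polynomial of degree at most `D` in the edge indicators. -/
def HasDegreeLE {n : ℕ} (f : EdgeConfig n → ℝ) (D : ℕ) : Prop :=
  ∃ P : MvPolynomial (Edge n) ℝ, P.totalDegree ≤ D ∧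
    ∀ G, f G = MvPolynomial.eval (fun e => if G e then 1 else 0) P

/-- The sequence of statistics `f n` distinguishes `SBM(n; p, Q)` (whose parameters may depend on
`n`) from `G(n, 1/2)` with high probability: the difference of the two means is
`ω` of the square root of the larger of the two variances, as `n → ∞`. -/
def Distinguishes {k : ℕ → ℕ} (M : ∀ n, SBM (k n)) (f : ∀ n, EdgeConfig n → ℝ) : Prop :=
  ∀ C : ℝ, ∀ᶠ n in Filter.atTop,
    C * √(max (var ((M n).mass n) (f n)) (var (erdosRenyiMass n) (f n))) <
      |expect ((M n).mass n) (f n) - expect (erdosRenyiMass n) (f n)|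

/-- `S` is the edge set of a copy of `H` in the complete graph on `Fin n`. -/
def IsCopy {V : Type*} (H : SimpleGraph V) {n : ℕ} (S : Finset (Edge n)) : Prop :=
  ∃ φ : V ↪ Fin n, ∀ e : Edge n, e ∈ S ↔ ∃ a b, H.Adj a b ∧ φ a = e.1.1 ∧ φ b = e.1.2

open Classical in
/-- The signed count of a graph `H` without isolated vertices: the sum, over all copies of `H` in
the complete graph on `Fin n`, of the product of the signs `2 G_e - 1` over the edges of the
copy. -/
noncomputable def signedCount {V : Type*} (H : SimpleGraph V) (n : ℕ) (G : EdgeConfig n) : ℝ :=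
  ∑ S : Finset (Edge n) with IsCopy H S, ∏ e ∈ S, (if G e then 1 else -1)

/-- The three patterns: the edge (star with one leaf), the wedge (star with two leaves) and the
4-cycle. -/
inductive Pattern
  | edge
  | wedge
  | fourCycle

/-- The number of vertices of a pattern. -/
def Pattern.size : Pattern → ℕ
  | .edge => 2
  | .wedge => 3
  | .fourCycle => 4

/-- The graph of a pattern. -/
def Pattern.graph : (H : Pattern) → SimpleGraph (Fin H.size)
  | .edge => SimpleGraph.starGraph (0 : Fin 2)
  | .wedge => SimpleGraph.starGraph (0 : Fin 3)
  | .fourCycle => SimpleGraph.cycleGraph 4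

end SBMTesting

/-!
A block model with label law `p` and connection matrix `Q` has Fourier coefficients
`coeff S = E ∏_{e ∈ S} Q (x e)`, the average being over i.i.d. labels. They are governed by three
numbers: `maxEntry = max |Q a b|` (called `q` here), the largest signed degree
`maxDegree = max_a |∑_b p_b Q a b|` (called `δ`) and the mean signed degree `meanDegree` (called
`m`), with `|m| ≤ δ ≤ q ≤ 1`.

*Upper bound.* By Cauchy–Schwarz in `L²(G(n, 1/2))`, the squared advantage of a test of degree `D`
is at most its variance under `G(n, 1/2)` times the Fourier mass `∑ coeff S ^ 2` over
`1 ≤ |S| ≤ D` (`HasDegreeLE.sq_expect_sub_le`). Averaging over the label of a vertex of degree one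
replaces its edge by a degree, so an isolated edge contributes a factor `m`, a leaf edge a factor at
most `δ` and any other edge a factor at most `q`. If `n |m|`, `n³ δ⁴` and `n q²` are bounded, a
count of half vertices shows that `coeff S ^ 2` is of order at most `n ^ (-v)`, where `v` is the
number of vertices covered by `S` (`SBM.pow_mul_coeff_le`), so that the Fourier mass is bounded
(`SBM.sum_coeff_sq_le`) and no such test distinguishes the models.

*Lower bound.* As all `p a ≥ c`, the coefficients of the edge, the wedge and the 4-cycle are `m`,
at least `c δ²` and at least `c⁴ q⁴`. In the variance of a signed count under the block model, pairs
of disjoint copies cancel, and a pair covering `u` vertices occurs of order `n ^ u` times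
(`SBM.max_var_signedCount_le`). Bounding the coefficients of the symmetric differences of
overlapping copies (`edge_pair_bound`, `wedge_pair_bound`, `fourCycle_pair_bound`) shows that the
signed count of a pattern succeeds as soon as `n` is large compared with the inverse of its rate,
the rates being `min |m| (m / δ)²` for the edge, `min δ^(4/3) (δ / q)²` for the wedge and `q²` for
the 4-cycle (`exists_const_separates`).

*Matching.* If `n` times each of the three rates is bounded, then so are `n |m|`, `n³ δ⁴` and
`n q²` (`SBM.small_of_rate_le`). The rates do not involve `n`, so a pattern of largest rate is
determined by `(p, Q)` alone, and its signed count succeeds whenever some constant-degree test does.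
-/

namespace SBMTesting

open Finset

/-! ### Averages over the labels -/

/-- The average of `F` over labels `x i` drawn independently from `M.p`. -/
noncomputable def SBM.labelMean {k n : ℕ} (M : SBM k) (F : (Fin n → Fin k) → ℝ) : ℝ :=
  ∑ x, (∏ i, M.p (x i)) * F x

theorem SBM.labelMean_const {k n : ℕ} (M : SBM k) (b : ℝ) :
    M.labelMean (fun _ : Fin n → Fin k => b) = b := by
  unfold SBM.labelMean
  rw [← sum_mul, ← Fintype.prod_sum (fun (_ : Fin n) (a : Fin k) => M.p a)]
  simp [M.p_sum]

theorem SBM.labelMean_mono {k n : ℕ} (M : SBM k) {F F' : (Fin n → Fin k) → ℝ}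
    (h : ∀ x, F x ≤ F' x) : M.labelMean F ≤ M.labelMean F' :=
  sum_le_sum fun x _ => mul_le_mul_of_nonneg_left (h x) (prod_nonneg fun _ _ => M.p_nonneg _)

theorem SBM.abs_labelMean_le {k n : ℕ} (M : SBM k) {F : (Fin n → Fin k) → ℝ} {b : ℝ}
    (h : ∀ x, |F x| ≤ b) : |M.labelMean F| ≤ b := by
  refine abs_le.2 ⟨?_, ?_⟩
  · rw [← M.labelMean_const (n := n) (-b)]
    exact M.labelMean_mono fun x => (abs_le.1 (h x)).1
  · rw [← M.labelMean_const (n := n) b]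
    exact M.labelMean_mono fun x => (abs_le.1 (h x)).2

/-- Redrawing the label of one vertex does not change the average. -/
theorem SBM.labelMean_resample {k n : ℕ} (M : SBM k) (i : Fin n) (F : (Fin n → Fin k) → ℝ) :
    M.labelMean F = M.labelMean fun x => ∑ a, M.p a * F (Function.update x i a) := by
  have hw : ∀ (x : Fin n → Fin k) (a : Fin k),
      (∏ j, M.p (Function.update x i a j)) * M.p (x i) = (∏ j, M.p (x j)) * M.p a := by
    intro x a
    rw [← mul_prod_erase univ _ (mem_univ i), ← mul_prod_erase univ (fun j => M.p (x j))
      (mem_univ i), Function.update_self, prod_congr rfl (g := fun j => M.p (x j))]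
    · ring
    · intro j hj
      rw [Function.update_of_ne (ne_of_mem_erase hj)]
  -- Exchanging the label of `i` with the fresh label `a` is an involution preserving the weight.
  let swap : (Fin n → Fin k) × Fin k → (Fin n → Fin k) × Fin k :=
    fun z => (Function.update z.1 i z.2, z.1 i)
  have hs : Function.Involutive swap := by
    rintro ⟨x, a⟩
    simp [swap]
  calc M.labelMean F
      = ∑ z : (Fin n → Fin k) × Fin k, (∏ j, M.p (z.1 j)) * M.p z.2 * F z.1 := by
        rw [Fintype.sum_prod_type]
        refine sum_congr rfl fun x _ => ?_
        simp only [mul_right_comm _ _ (F x)]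
        rw [← mul_sum, M.p_sum, mul_one]
    _ = ∑ z : (Fin n → Fin k) × Fin k, (∏ j, M.p ((swap z).1 j)) * M.p (swap z).2 *
          F (swap z).1 := (Equiv.sum_comp hs.toPerm _).symm
    _ = _ := by
        rw [Fintype.sum_prod_type]
        refine sum_congr rfl fun x _ => ?_
        rw [mul_sum]
        refine sum_congr rfl fun a _ => ?_
        simp only [swap]
        rw [hw, mul_assoc]

/-- Functions of disjoint sets of labels are independent. -/
theorem SBM.labelMean_mul {k n : ℕ} (M : SBM k) (A : Finset (Fin n))
    {F F' : (Fin n → Fin k) → ℝ} (hF : ∀ x y, (∀ i ∈ A, x i = y i) → F x = F y)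
    (hF' : ∀ x y, (∀ i ∉ A, x i = y i) → F' x = F' y) :
    M.labelMean (fun x => F x * F' x) = M.labelMean F * M.labelMean F' := by
  -- Exchange the labels in `A` between two independent copies of the labelling.
  let swap : (Fin n → Fin k) × (Fin n → Fin k) → (Fin n → Fin k) × (Fin n → Fin k) :=
    fun z => (A.piecewise z.2 z.1, A.piecewise z.1 z.2)
  have hs : Function.Involutive swap := by
    rintro ⟨x, y⟩
    ext i <;> by_cases hi : i ∈ A <;> simp [swap, hi]
  have hw : ∀ z, (∏ j, M.p ((swap z).1 j)) * ∏ j, M.p ((swap z).2 j) =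
      (∏ j, M.p (z.1 j)) * ∏ j, M.p (z.2 j) := by
    intro z
    rw [← prod_mul_distrib, ← prod_mul_distrib]
    refine prod_congr rfl fun j _ => ?_
    by_cases hj : j ∈ A <;> simp [swap, hj, mul_comm]
  symm
  calc M.labelMean F * M.labelMean F'
      = ∑ z : (Fin n → Fin k) × (Fin n → Fin k),
          ((∏ j, M.p (z.1 j)) * ∏ j, M.p (z.2 j)) * (F z.1 * F' z.2) := by
        unfold SBM.labelMean
        rw [sum_mul_sum, Fintype.sum_prod_type]
        exact sum_congr rfl fun x _ => sum_congr rfl fun y _ => by ring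
    _ = ∑ z : (Fin n → Fin k) × (Fin n → Fin k),
          ((∏ j, M.p ((swap z).1 j)) * ∏ j, M.p ((swap z).2 j)) *
            (F (swap z).1 * F' (swap z).2) := (Equiv.sum_comp hs.toPerm _).symm
    _ = ∑ z : (Fin n → Fin k) × (Fin n → Fin k),
          ((∏ j, M.p (z.1 j)) * ∏ j, M.p (z.2 j)) * (F z.2 * F' z.2) := by
        refine sum_congr rfl fun z _ => ?_
        rw [hw, hF (swap z).1 z.2, hF' (swap z).2 z.2]
        · intro i hi
          simp [swap, hi]
        · intro i hi
          simp [swap, hi]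
    _ = M.labelMean (fun _ : Fin n → Fin k => (1 : ℝ)) *
          M.labelMean (fun x => F x * F' x) := by
        unfold SBM.labelMean
        rw [sum_mul_sum, Fintype.sum_prod_type]
        exact sum_congr rfl fun x _ => sum_congr rfl fun y _ => by ring
    _ = _ := by rw [M.labelMean_const, one_mul]

/-! ### Fourier coefficients -/

/-- The Fourier character `∏ e ∈ S, (2 G_e - 1)`. -/
noncomputable def character {n : ℕ} (S : Finset (Edge n)) (G : EdgeConfig n) : ℝ :=
  ∏ e ∈ S, (if G e then 1 else -1)

/-- The conditional mean of the sign of the edge `e` given the labels `x`. -/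
noncomputable def SBM.edgeMean {k n : ℕ} (M : SBM k) (x : Fin n → Fin k) (e : Edge n) : ℝ :=
  M.Q (x e.1.1) (x e.1.2)

/-- The Fourier coefficient of the block model at `S`: the mean of `character S`, see
`SBM.expect_character`. -/
noncomputable def SBM.coeff {k n : ℕ} (M : SBM k) (S : Finset (Edge n)) : ℝ :=
  M.labelMean fun x => ∏ e ∈ S, M.edgeMean x e

theorem character_mul {n : ℕ} (S T : Finset (Edge n)) (G : EdgeConfig n) :
    character S G * character T G = character (symmDiff S T) G := by
  have h : ∀ U : Finset (Edge n), character U G =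
      ∏ e, if e ∈ U then (if G e then (1 : ℝ) else -1) else 1 := by
    intro U
    rw [prod_ite_mem, univ_inter]
    rfl
  rw [h, h, h, ← prod_mul_distrib]
  refine prod_congr rfl fun e _ => ?_
  by_cases hS : e ∈ S <;> by_cases hT : e ∈ T <;> by_cases hG : G e = true <;>
    simp [mem_symmDiff, hS, hT, hG]

theorem SBM.expect_character {k n : ℕ} (M : SBM k) (S : Finset (Edge n)) :
    expect (M.mass n) (character S) = M.coeff S := by
  unfold expect SBM.mass SBM.coeff SBM.labelMean
  simp only [sum_mul]
  rw [sum_comm]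
  refine sum_congr rfl fun x _ => ?_
  simp only [mul_assoc]
  rw [← mul_sum]
  congr 1
  have h : ∀ G : EdgeConfig n, (∏ e : Edge n,
      if G e then (1 + M.Q (x e.1.1) (x e.1.2)) / 2 else (1 - M.Q (x e.1.1) (x e.1.2)) / 2) *
        character S G = ∏ e : Edge n, (
          (if G e then (1 + M.edgeMean x e) / 2 else (1 - M.edgeMean x e) / 2) *
          (if e ∈ S then (if G e then (1 : ℝ) else -1) else 1)) := by
    intro G
    rw [prod_mul_distrib, prod_ite_mem, univ_inter]
    rfl
  rw [sum_congr rfl fun G _ => h G, ← Fintype.prod_sum (fun (e : Edge n) (b : Bool) =>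
    (if b then (1 + M.edgeMean x e) / 2 else (1 - M.edgeMean x e) / 2) *
      (if e ∈ S then (if b then (1 : ℝ) else -1) else 1))]
  have h' : ∏ e ∈ S, M.edgeMean x e = ∏ e, if e ∈ S then M.edgeMean x e else 1 := by
    rw [prod_ite_mem, univ_inter]
  rw [h']
  refine prod_congr rfl fun e _ => ?_
  rw [Fintype.sum_bool]
  by_cases he : e ∈ S <;> simp [he] <;> ring

theorem SBM.coeff_empty {k n : ℕ} (M : SBM k) : M.coeff (∅ : Finset (Edge n)) = 1 := by
  simp [SBM.coeff, SBM.labelMean_const]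

/-- The block model with one community and `Q = 0`, that is, `G(n, 1/2)`. -/
noncomputable def nullModel : SBM 1 where
  p := fun _ => 1
  Q := 0
  p_nonneg := fun _ => zero_le_one
  p_sum := by simp
  Q_symm := Matrix.isSymm_zero
  abs_Q_le_one := by simp

theorem nullModel_mass (n : ℕ) : nullModel.mass n = erdosRenyiMass n := by
  funext G
  simp [SBM.mass, nullModel, erdosRenyiMass]

theorem nullModel_coeff {n : ℕ} (S : Finset (Edge n)) :
    nullModel.coeff S = if S = ∅ then 1 else 0 := by
  split_ifs with h
  · rw [h, SBM.coeff_empty]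
  · obtain ⟨e, he⟩ := nonempty_iff_ne_empty.2 h
    have : ∀ x : Fin n → Fin 1, ∏ e ∈ S, nullModel.edgeMean x e = 0 := fun x =>
      prod_eq_zero he (by simp [SBM.edgeMean, nullModel])
    simp only [SBM.coeff, this, SBM.labelMean_const]

theorem expect_sum_mul {ι : Type*} {n : ℕ} (μ : EdgeConfig n → ℝ) (s : Finset ι) (a : ι → ℝ)
    (g : ι → EdgeConfig n → ℝ) :
    expect μ (fun G => ∑ i ∈ s, a i * g i G) = ∑ i ∈ s, a i * expect μ (g i) := by
  unfold expect
  simp only [mul_sum]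
  rw [sum_comm]
  exact sum_congr rfl fun i _ => sum_congr rfl fun G _ => by ring

theorem SBM.expect_sum_character {k n : ℕ} (M : SBM k) (s : Finset (Finset (Edge n)))
    (a : Finset (Edge n) → ℝ) :
    expect (M.mass n) (fun G => ∑ S ∈ s, a S * character S G) = ∑ S ∈ s, a S * M.coeff S := by
  rw [expect_sum_mul]
  simp only [M.expect_character]

theorem SBM.var_eq {k n : ℕ} (M : SBM k) (f : EdgeConfig n → ℝ) :
    var (M.mass n) f = expect (M.mass n) (fun G => f G * f G) - expect (M.mass n) f ^ 2 := by
  have h : ∀ b : ℝ, ∑ G, M.mass n G * (f G - b) ^ 2 =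
      ∑ G, M.mass n G * (f G * f G) - 2 * b * ∑ G, M.mass n G * f G + b ^ 2 := by
    intro b
    have h1 : b ^ 2 = ∑ G, M.mass n G * b ^ 2 := by rw [← sum_mul, M.sum_mass, one_mul]
    conv_rhs => rw [h1]
    rw [mul_sum, ← sum_sub_distrib, ← sum_add_distrib]
    exact sum_congr rfl fun G _ => by ring
  unfold var
  conv_lhs => unfold expect
  rw [h]
  unfold expect
  ring

theorem SBM.var_sum_character {k n : ℕ} (M : SBM k) (s : Finset (Finset (Edge n)))
    (a : Finset (Edge n) → ℝ) :
    var (M.mass n) (fun G => ∑ S ∈ s, a S * character S G) =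
      ∑ S ∈ s, ∑ T ∈ s, a S * a T * (M.coeff (symmDiff S T) - M.coeff S * M.coeff T) := by
  rw [M.var_eq, M.expect_sum_character]
  have h : (fun G : EdgeConfig n => (∑ S ∈ s, a S * character S G) *
      ∑ S ∈ s, a S * character S G) = fun G => ∑ z ∈ s ×ˢ s,
        (a z.1 * a z.2) * character (symmDiff z.1 z.2) G := by
    funext G
    rw [sum_mul_sum, sum_product]
    refine sum_congr rfl fun S _ => sum_congr rfl fun T _ => ?_
    rw [← character_mul]
    ring
  rw [h, expect_sum_mul _ _ (fun z => a z.1 * a z.2)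
    (fun z : Finset (Edge n) × Finset (Edge n) => character (symmDiff z.1 z.2)), sq, sum_mul_sum,
    sum_product, ← sum_sub_distrib]
  refine sum_congr rfl fun S _ => ?_
  rw [← sum_sub_distrib]
  refine sum_congr rfl fun T _ => ?_
  rw [M.expect_character]
  ring

theorem var_erdosRenyi_sum_character {n : ℕ} (s : Finset (Finset (Edge n)))
    (a : Finset (Edge n) → ℝ) :
    var (erdosRenyiMass n) (fun G => ∑ S ∈ s, a S * character S G) =
      ∑ S ∈ s with S ≠ ∅, a S ^ 2 := by
  rw [← nullModel_mass, SBM.var_sum_character, sum_filter]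
  refine sum_congr rfl fun S hS => ?_
  rw [sum_eq_single_of_mem S hS]
  · by_cases h : S = ∅ <;> simp [nullModel_coeff, h, sq]
  · intro T _ hT
    have h0 : symmDiff S T ≠ ∅ := fun h => hT (symmDiff_eq_bot.1 h).symm
    have h1 : ¬ (S = ∅ ∧ T = ∅) := fun h => hT (h.2.trans h.1.symm)
    by_cases h2 : S = ∅
    · have h3 : T ≠ ∅ := fun h => h1 ⟨h2, h⟩
      simp [nullModel_coeff, h0, h3]
    · simp [nullModel_coeff, h0, h2]

theorem expect_erdosRenyi_sum_character {n : ℕ} (s : Finset (Finset (Edge n)))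
    (a : Finset (Edge n) → ℝ) :
    expect (erdosRenyiMass n) (fun G => ∑ S ∈ s, a S * character S G) =
      ∑ S ∈ s, a S * (if S = ∅ then 1 else 0) := by
  rw [← nullModel_mass, SBM.expect_sum_character]
  simp only [nullModel_coeff]

theorem SBM.expect_sub_expect {k n : ℕ} (M : SBM k) (s : Finset (Finset (Edge n)))
    (a : Finset (Edge n) → ℝ) :
    expect (M.mass n) (fun G => ∑ S ∈ s, a S * character S G) -
      expect (erdosRenyiMass n) (fun G => ∑ S ∈ s, a S * character S G) =
      ∑ S ∈ s with S ≠ ∅, a S * M.coeff S := by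
  rw [M.expect_sum_character, expect_erdosRenyi_sum_character, ← sum_sub_distrib, sum_filter]
  refine sum_congr rfl fun S _ => ?_
  by_cases h : S = ∅ <;> simp [h, M.coeff_empty]

/-! ### Low-degree polynomials -/

/-- A polynomial of degree at most `D` in the edge indicators is a combination of characters of
edge sets of size at most `D`. -/
theorem HasDegreeLE.exists_character_sum {n D : ℕ} {f : EdgeConfig n → ℝ} (hf : HasDegreeLE f D) :
    ∃ a : Finset (Edge n) → ℝ, f = fun G => ∑ S with S.card ≤ D, a S * character S G := by
  obtain ⟨P, hP, hf⟩ := hf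
  let s : Finset (Finset (Edge n)) := univ.filter fun S => S.card ≤ D
  have hmem : f ∈ Submodule.span ℝ ((character : Finset (Edge n) → EdgeConfig n → ℝ) '' s) := by
    have hf' : f = ∑ m ∈ P.support, P.coeff m •
        fun G : EdgeConfig n => ∏ e ∈ m.support, (if G e then (1 : ℝ) else 0) ^ m e := by
      funext G
      rw [hf, MvPolynomial.eval_eq]
      simp [Finset.sum_apply]
    rw [hf']
    refine Submodule.sum_mem _ fun m hm => Submodule.smul_mem _ _ ?_
    have hcard : m.support.card ≤ D := by
      refine le_trans ?_ ((MvPolynomial.le_totalDegree hm).trans hP)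
      rw [card_eq_sum_ones]
      exact sum_le_sum fun e he => Nat.one_le_iff_ne_zero.2 (Finsupp.mem_support_iff.1 he)
    have hmon : (fun G : EdgeConfig n => ∏ e ∈ m.support, (if G e then (1 : ℝ) else 0) ^ m e) =
        ∑ S ∈ m.support.powerset, ((1 / 2 : ℝ) ^ m.support.card) • character S := by
      funext G
      rw [Finset.sum_apply]
      simp only [Pi.smul_apply, smul_eq_mul, character]
      rw [← mul_sum, ← prod_one_add, ← prod_const, ← prod_mul_distrib]
      refine prod_congr rfl fun e he => ?_
      have := Finsupp.mem_support_iff.1 he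
      by_cases hG : G e = true <;> simp [hG, this]
      norm_num
    rw [hmon]
    refine Submodule.sum_mem _ fun S hS => Submodule.smul_mem _ _ (Submodule.subset_span ?_)
    refine ⟨S, ?_, rfl⟩
    simpa [s] using (card_le_card (mem_powerset.1 hS)).trans hcard
  obtain ⟨a, ha⟩ := (Submodule.mem_span_image_finset_iff_exists_fun' ℝ).1 hmem
  refine ⟨a, ?_⟩
  funext G
  rw [← ha, Finset.sum_apply]
  rfl

/-- The squared advantage of a test of degree at most `D` is at most the Fourier mass of the block
model on degrees `1, …, D`. -/
theorem HasDegreeLE.sq_expect_sub_le {k n D : ℕ} (M : SBM k) {f : EdgeConfig n → ℝ}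
    (hf : HasDegreeLE f D) :
    (expect (M.mass n) f - expect (erdosRenyiMass n) f) ^ 2 ≤
      var (erdosRenyiMass n) f * ∑ S : Finset (Edge n) with S.card ≤ D ∧ S ≠ ∅, M.coeff S ^ 2 := by
  obtain ⟨a, rfl⟩ := hf.exists_character_sum
  rw [M.expect_sub_expect, var_erdosRenyi_sum_character, filter_filter]
  exact sum_mul_sq_le_sq_mul_sq _ _ _

/-! ### The size of a block model -/

/-- The signed expected degree of the label `a`, per vertex. -/
noncomputable def SBM.degree {k : ℕ} (M : SBM k) (a : Fin k) : ℝ := ∑ b, M.p b * M.Q a b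

/-- The mean of `SBM.degree`; this is the Fourier coefficient of an edge. -/
noncomputable def SBM.meanDegree {k : ℕ} (M : SBM k) : ℝ := ∑ a, M.p a * M.degree a

/-- The largest absolute value of `SBM.degree`. -/
noncomputable def SBM.maxDegree {k : ℕ} (M : SBM k) : ℝ := ⨆ a, |M.degree a|

/-- The largest absolute value of an entry of `Q`. -/
noncomputable def SBM.maxEntry {k : ℕ} (M : SBM k) : ℝ := ⨆ z : Fin k × Fin k, |M.Q z.1 z.2|

theorem SBM.nonempty {k : ℕ} (M : SBM k) : Nonempty (Fin k) := by
  by_contra h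
  rw [not_nonempty_iff] at h
  simpa using M.p_sum

theorem SBM.abs_sum_p_mul_le {k : ℕ} (M : SBM k) {h : Fin k → ℝ} {b : ℝ} (hb : ∀ a, |h a| ≤ b) :
    |∑ a, M.p a * h a| ≤ b := by
  refine (abs_sum_le_sum_abs _ _).trans ?_
  calc ∑ a, |M.p a * h a| ≤ ∑ a, M.p a * b := by
        refine sum_le_sum fun a _ => ?_
        rw [abs_mul, abs_of_nonneg (M.p_nonneg a)]
        exact mul_le_mul_of_nonneg_left (hb a) (M.p_nonneg a)
    _ = b := by rw [← sum_mul, M.p_sum, one_mul]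

theorem SBM.abs_Q_le {k : ℕ} (M : SBM k) (a b : Fin k) : |M.Q a b| ≤ M.maxEntry :=
  le_ciSup (f := fun z : Fin k × Fin k => |M.Q z.1 z.2|) (Set.finite_range _).bddAbove (a, b)

theorem SBM.abs_degree_le {k : ℕ} (M : SBM k) (a : Fin k) : |M.degree a| ≤ M.maxDegree :=
  le_ciSup (f := fun a => |M.degree a|) (Set.finite_range _).bddAbove a

theorem SBM.exists_abs_Q_eq {k : ℕ} (M : SBM k) : ∃ a b, |M.Q a b| = M.maxEntry := by
  have := M.nonempty
  obtain ⟨z, hz⟩ := exists_eq_ciSup_of_finite (f := fun z : Fin k × Fin k => |M.Q z.1 z.2|)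
  exact ⟨z.1, z.2, hz⟩

theorem SBM.exists_abs_degree_eq {k : ℕ} (M : SBM k) : ∃ a, |M.degree a| = M.maxDegree := by
  have := M.nonempty
  exact exists_eq_ciSup_of_finite

theorem SBM.maxEntry_nonneg {k : ℕ} (M : SBM k) : 0 ≤ M.maxEntry := by
  obtain ⟨a, b, h⟩ := M.exists_abs_Q_eq
  exact h ▸ abs_nonneg _

theorem SBM.maxDegree_nonneg {k : ℕ} (M : SBM k) : 0 ≤ M.maxDegree := by
  obtain ⟨a, h⟩ := M.exists_abs_degree_eq
  exact h ▸ abs_nonneg _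

theorem SBM.maxEntry_le_one {k : ℕ} (M : SBM k) : M.maxEntry ≤ 1 := by
  obtain ⟨a, b, h⟩ := M.exists_abs_Q_eq
  exact h ▸ M.abs_Q_le_one a b

theorem SBM.maxDegree_le_maxEntry {k : ℕ} (M : SBM k) : M.maxDegree ≤ M.maxEntry := by
  obtain ⟨a, h⟩ := M.exists_abs_degree_eq
  exact h ▸ M.abs_sum_p_mul_le fun b => M.abs_Q_le a b

theorem SBM.abs_meanDegree_le {k : ℕ} (M : SBM k) : |M.meanDegree| ≤ M.maxDegree :=
  M.abs_sum_p_mul_le fun a => M.abs_degree_le a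

/-! ### Vertices of edge sets -/

/-- The two endpoints of an edge. -/
def ends {n : ℕ} (e : Edge n) : Finset (Fin n) := {e.1.1, e.1.2}

/-- The vertices covered by an edge set. -/
def vertexSet {n : ℕ} (S : Finset (Edge n)) : Finset (Fin n) := S.biUnion ends

/-- The endpoint of `e` other than its endpoint `v`. -/
def otherEnd {n : ℕ} (e : Edge n) (v : Fin n) : Fin n := if v = e.1.1 then e.1.2 else e.1.1

theorem mem_ends {n : ℕ} {e : Edge n} {v : Fin n} : v ∈ ends e ↔ v = e.1.1 ∨ v = e.1.2 := by
  simp [ends]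

theorem card_ends {n : ℕ} (e : Edge n) : (ends e).card = 2 := card_pair e.2.ne

theorem mem_vertexSet {n : ℕ} {S : Finset (Edge n)} {v : Fin n} :
    v ∈ vertexSet S ↔ ∃ e ∈ S, v ∈ ends e := mem_biUnion

theorem ends_subset_vertexSet {n : ℕ} {S : Finset (Edge n)} {e : Edge n} (he : e ∈ S) :
    ends e ⊆ vertexSet S := subset_biUnion_of_mem ends he

theorem otherEnd_mem {n : ℕ} (e : Edge n) (v : Fin n) : otherEnd e v ∈ ends e := by
  unfold otherEnd
  split_ifs <;> simp [ends]

theorem otherEnd_ne {n : ℕ} (e : Edge n) (v : Fin n) : otherEnd e v ≠ v := by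
  unfold otherEnd
  split_ifs with h
  · rw [h]
    exact e.2.ne'
  · exact fun h' => h h'.symm

theorem eq_or_eq_otherEnd {n : ℕ} {e : Edge n} {u v : Fin n} (hu : u ∈ ends e) (hv : v ∈ ends e) :
    u = v ∨ u = otherEnd e v := by
  unfold otherEnd
  rw [mem_ends] at hu hv
  split_ifs with h
  · rw [h]; exact hu
  · rcases hu with hu | hu
    · exact Or.inr hu
    · exact Or.inl (hu.trans (hv.resolve_left h).symm)

theorem edge_ext {n : ℕ} {e e' : Edge n} {u v : Fin n} (huv : u ≠ v) (hu : u ∈ ends e)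
    (hv : v ∈ ends e) (hu' : u ∈ ends e') (hv' : v ∈ ends e') : e = e' := by
  have h1 := e.2
  have h2 := e'.2
  rw [mem_ends] at hu hv hu' hv'
  apply Subtype.ext
  apply Prod.ext <;> grind

theorem SBM.edgeMean_eq {k n : ℕ} (M : SBM k) (x : Fin n → Fin k) {e : Edge n} {v : Fin n}
    (hv : v ∈ ends e) : M.edgeMean x e = M.Q (x (otherEnd e v)) (x v) := by
  unfold SBM.edgeMean otherEnd
  split_ifs with h
  · rw [h, M.Q_symm.apply]
  · rw [(mem_ends.1 hv).resolve_left h]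

theorem SBM.edgeMean_congr {k n : ℕ} (M : SBM k) {x y : Fin n → Fin k} {e : Edge n}
    (h : ∀ v ∈ ends e, x v = y v) : M.edgeMean x e = M.edgeMean y e := by
  unfold SBM.edgeMean
  rw [h _ (mem_ends.2 (Or.inl rfl)), h _ (mem_ends.2 (Or.inr rfl))]

theorem SBM.edgeMean_update {k n : ℕ} (M : SBM k) (x : Fin n → Fin k) {e : Edge n} {v : Fin n}
    (hv : v ∉ ends e) (a : Fin k) : M.edgeMean (Function.update x v a) e = M.edgeMean x e :=
  M.edgeMean_congr fun u hu => Function.update_of_ne (by rintro rfl; exact hv hu) _ _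

/-! ### Averaging out leaves -/

/-- If each edge `e ∈ T` has an endpoint `tail e` which lies on no other edge of `T` and does not
influence `F`, then averaging over the labels of these endpoints replaces each edge by the degree
of its other endpoint. -/
theorem SBM.labelMean_peel {k n : ℕ} (M : SBM k) (tail : Edge n → Fin n) (T : Finset (Edge n))
    (htail : ∀ e ∈ T, tail e ∈ ends e) (hT : ∀ e ∈ T, ∀ e' ∈ T, tail e ∈ ends e' → e = e')
    (F : (Fin n → Fin k) → ℝ) (hF : ∀ e ∈ T, ∀ x a, F (Function.update x (tail e) a) = F x) :
    M.labelMean (fun x => (∏ e ∈ T, M.edgeMean x e) * F x) =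
      M.labelMean fun x => (∏ e ∈ T, M.degree (x (otherEnd e (tail e)))) * F x := by
  induction T using Finset.induction generalizing F with
  | empty => simp
  | insert e₀ T h₀ ih =>
    have hne : ∀ e ∈ T, tail e ∉ ends e₀ := fun e he h =>
      h₀ (hT e (mem_insert_of_mem he) e₀ (mem_insert_self _ _) h ▸ he)
    have hne' : ∀ e ∈ T, tail e₀ ∉ ends e := fun e he h =>
      h₀ ((hT e₀ (mem_insert_self _ _) e (mem_insert_of_mem he) h).symm ▸ he)
    have h1 := ih (fun e he => htail e (mem_insert_of_mem he))
      (fun e he e' he' => hT e (mem_insert_of_mem he) e' (mem_insert_of_mem he'))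
      (fun x => M.edgeMean x e₀ * F x) (fun e he x a => by
        rw [M.edgeMean_update x (hne e he), hF e (mem_insert_of_mem he)])
    simp only [prod_insert h₀]
    rw [show (fun x => M.edgeMean x e₀ * (∏ e ∈ T, M.edgeMean x e) * F x) = fun x =>
      (∏ e ∈ T, M.edgeMean x e) * (M.edgeMean x e₀ * F x) from by funext x; ring, h1,
      M.labelMean_resample (tail e₀)]
    congr 1
    funext x
    have h2 : ∀ a, ∏ e ∈ T, M.degree (Function.update x (tail e₀) a (otherEnd e (tail e))) =
        ∏ e ∈ T, M.degree (x (otherEnd e (tail e))) := fun a =>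
      prod_congr rfl fun e he => by
        rw [Function.update_of_ne fun h => hne' e he (by rw [← h]; exact otherEnd_mem _ _)]
    have h3 : ∀ a, M.edgeMean (Function.update x (tail e₀) a) e₀ =
        M.Q (x (otherEnd e₀ (tail e₀))) a := fun a => by
      rw [M.edgeMean_eq _ (htail e₀ (mem_insert_self _ _)), Function.update_self,
        Function.update_of_ne (otherEnd_ne _ _)]
    simp only [h2, h3, hF e₀ (mem_insert_self _ _)]
    rw [SBM.degree, sum_mul, sum_mul]
    exact sum_congr rfl fun a _ => by ring

/-- Each edge with a private endpoint contributes a factor `maxDegree`, each other edge a factor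
`maxEntry`. -/
theorem SBM.abs_coeff_le {k n : ℕ} (M : SBM k) (tail : Edge n → Fin n) {S T : Finset (Edge n)}
    (hTS : T ⊆ S) (htail : ∀ e ∈ T, tail e ∈ ends e)
    (hT : ∀ e ∈ T, ∀ e' ∈ S, tail e ∈ ends e' → e = e') :
    |M.coeff S| ≤ M.maxDegree ^ T.card * M.maxEntry ^ (S \ T).card := by
  unfold SBM.coeff
  have h : (fun x : Fin n → Fin k => ∏ e ∈ S, M.edgeMean x e) = fun x =>
      (∏ e ∈ T, M.edgeMean x e) * ∏ e ∈ S \ T, M.edgeMean x e := by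
    funext x
    rw [mul_comm, prod_sdiff hTS]
  rw [h, M.labelMean_peel tail T htail fun e he e' he' => hT e he e' (hTS he')]
  · refine M.abs_labelMean_le fun x => ?_
    rw [abs_mul, abs_prod, abs_prod]
    refine mul_le_mul ?_ ?_ (prod_nonneg fun _ _ => abs_nonneg _)
      (pow_nonneg M.maxDegree_nonneg _)
    · rw [← prod_const]
      exact prod_le_prod (fun _ _ => abs_nonneg _) fun e _ => M.abs_degree_le _
    · rw [← prod_const]
      exact prod_le_prod (fun _ _ => abs_nonneg _) fun e _ => M.abs_Q_le _ _
  · intro e he x a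
    refine prod_congr rfl fun e' he' => M.edgeMean_update x (fun h => ?_) a
    rw [mem_sdiff] at he'
    exact he'.2 (hT e he e' he'.1 h ▸ he)

theorem SBM.abs_coeff_le_maxEntry {k n : ℕ} (M : SBM k) (S : Finset (Edge n)) :
    |M.coeff S| ≤ M.maxEntry ^ S.card := by
  simpa using M.abs_coeff_le (S := S) (T := ∅) (fun e => e.1.1) (by simp) (by simp) (by simp)

theorem SBM.coeff_union {k n : ℕ} (M : SBM k) {S T : Finset (Edge n)}
    (h : Disjoint (vertexSet S) (vertexSet T)) : M.coeff (S ∪ T) = M.coeff S * M.coeff T := by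
  have hST : Disjoint S T := by
    rw [disjoint_left] at h ⊢
    exact fun e hS hT => h (ends_subset_vertexSet hS (mem_ends.2 (Or.inl rfl)))
      (ends_subset_vertexSet hT (mem_ends.2 (Or.inl rfl)))
  unfold SBM.coeff
  simp only [prod_union hST]
  refine M.labelMean_mul (vertexSet S) (fun x y hxy => ?_) (fun x y hxy => ?_)
  · exact prod_congr rfl fun e he => M.edgeMean_congr fun v hv =>
      hxy v (ends_subset_vertexSet he hv)
  · exact prod_congr rfl fun e he => M.edgeMean_congr fun v hv =>
      hxy v (disjoint_right.1 h (ends_subset_vertexSet he hv))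

theorem SBM.labelMean_eval {k n : ℕ} (M : SBM k) (i : Fin n) (h : Fin k → ℝ) :
    M.labelMean (fun x : Fin n → Fin k => h (x i)) = ∑ a, M.p a * h a := by
  rw [M.labelMean_resample i]
  simp only [Function.update_self, M.labelMean_const]

theorem SBM.coeff_singleton {k n : ℕ} (M : SBM k) (e : Edge n) :
    M.coeff {e} = M.meanDegree := by
  have h := M.labelMean_peel (fun e => e.1.1) {e} (by simp [mem_ends]) (by simp) (fun _ => 1)
    (by simp)
  simp only [mul_one, prod_singleton] at h
  unfold SBM.coeff
  simp only [prod_singleton]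
  rw [h, M.labelMean_eval]
  rfl

/-! ### Fourier coefficients below the detection thresholds -/

/-- The number of edges of `S` at the vertex `v`. -/
def degreeIn {n : ℕ} (S : Finset (Edge n)) (v : Fin n) : ℕ := (S.filter fun e => v ∈ ends e).card

theorem sum_vertexSet {n : ℕ} (S : Finset (Edge n)) (g : Fin n → ℕ) :
    ∑ v ∈ vertexSet S, degreeIn S v * g v = ∑ e ∈ S, ∑ v ∈ ends e, g v := by
  have h : ∀ v, degreeIn S v * g v = ∑ e ∈ S, if v ∈ ends e then g v else 0 := by
    intro v
    rw [← sum_filter, sum_const, smul_eq_mul, degreeIn]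
  simp only [h]
  rw [sum_comm]
  refine sum_congr rfl fun e he => ?_
  rw [sum_ite_mem, inter_eq_right.2 (ends_subset_vertexSet he)]

theorem one_le_degreeIn {n : ℕ} {S : Finset (Edge n)} {v : Fin n} (hv : v ∈ vertexSet S) :
    1 ≤ degreeIn S v := by
  obtain ⟨e, he, hv⟩ := mem_vertexSet.1 hv
  exact card_pos.2 ⟨e, mem_filter.2 ⟨he, hv⟩⟩

/-- In a graph without isolated edges, a leaf edge pays for three and each other edge for two half
vertices. -/
theorem two_mul_card_vertexSet_le {n : ℕ} {S L : Finset (Edge n)} (hLS : L ⊆ S)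
    (hL : ∀ e ∈ S, ∀ v ∈ ends e, degreeIn S v = 1 → e ∈ L)
    (hS : ∀ e ∈ S, ∃ v ∈ ends e, degreeIn S v ≠ 1) :
    2 * (vertexSet S).card ≤ 3 * L.card + 2 * (S \ L).card := by
  calc 2 * (vertexSet S).card = ∑ v ∈ vertexSet S, 2 := by rw [sum_const, smul_eq_mul, mul_comm]
    _ ≤ ∑ v ∈ vertexSet S, degreeIn S v * (1 + if degreeIn S v = 1 then 1 else 0) := by
        -- A vertex of degree one is counted twice, any other vertex at least twice already.
        refine sum_le_sum fun v hv => ?_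
        have := one_le_degreeIn hv
        split_ifs <;> omega
    _ = ∑ e ∈ S, ∑ v ∈ ends e, (1 + if degreeIn S v = 1 then 1 else 0) := sum_vertexSet S _
    _ ≤ ∑ e ∈ S, (2 + if e ∈ L then 1 else 0) := by
        refine sum_le_sum fun e he => ?_
        rw [sum_add_distrib, sum_const, card_ends, smul_eq_mul, mul_one]
        refine Nat.add_le_add_left ?_ 2
        rw [← card_filter]
        split_ifs with h
        · obtain ⟨v, hv, hv'⟩ := hS e he
          refine Nat.le_of_lt_succ ?_
          exact (card_lt_card (filter_ssubset.2 ⟨v, hv, hv'⟩)).trans_eq (card_ends e)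
        · rw [Nat.le_zero, card_eq_zero, filter_eq_empty_iff]
          exact fun v hv hv' => h (hL e he v hv hv')
    _ = 2 * S.card + L.card := by
        rw [sum_add_distrib, sum_const, smul_eq_mul, mul_comm, sum_ite_mem,
          inter_eq_right.2 hLS]
        simp
    _ = _ := by
        have := card_sdiff_add_card_eq_card hLS
        omega

theorem vertexSet_insert {n : ℕ} (S : Finset (Edge n)) (e : Edge n) :
    vertexSet (insert e S) = ends e ∪ vertexSet S := biUnion_insert

theorem eq_of_degreeIn_eq_one {n : ℕ} {S : Finset (Edge n)} {v : Fin n} (h : degreeIn S v = 1)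
    {e e' : Edge n} (he : e ∈ S) (he' : e' ∈ S) (hv : v ∈ ends e) (hv' : v ∈ ends e') : e = e' :=
  card_le_one.1 (show (S.filter fun e => v ∈ ends e).card ≤ 1 from h.le) e
    (mem_filter.2 ⟨he, hv⟩) e' (mem_filter.2 ⟨he', hv'⟩)

/-- Below all three detection thresholds, the Fourier coefficient at a graph on `v` vertices is of
order at most `n ^ (- v / 2)`. -/
theorem SBM.pow_mul_coeff_le {k n : ℕ} (M : SBM k) {K : ℝ} (hK : 1 ≤ K)
    (h1 : n * |M.meanDegree| ≤ K) (h2 : (n : ℝ) ^ 3 * M.maxDegree ^ 4 ≤ K)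
    (h3 : n * M.maxEntry ^ 2 ≤ K) (S : Finset (Edge n)) :
    (n : ℝ) ^ (2 * (vertexSet S).card) * M.coeff S ^ 4 ≤ K ^ (4 * S.card) := by
  induction hs : S.card using Nat.strong_induction_on generalizing S with
  | _ s ih =>
    subst hs
    by_cases hS : ∀ e ∈ S, ∃ v ∈ ends e, degreeIn S v ≠ 1
    · rcases Nat.eq_zero_or_pos n with rfl | hn
      · have : S = ∅ := eq_empty_of_forall_notMem fun e => e.1.1.elim0
        subst this
        simp [vertexSet, M.coeff_empty]
      have hn1 : (1 : ℝ) ≤ n := by exact_mod_cast hn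
      classical
      let L := S.filter fun e => ∃ v ∈ ends e, degreeIn S v = 1
      have hL : ∀ e : Edge n, ∃ v, e ∈ L → v ∈ ends e ∧ degreeIn S v = 1 := by
        intro e
        by_cases he : e ∈ L
        · obtain ⟨v, hv⟩ := (mem_filter.1 he).2
          exact ⟨v, fun _ => hv⟩
        · exact ⟨e.1.1, fun h => (he h).elim⟩
      choose tail htail using hL
      have hLS : L ⊆ S := filter_subset _ _
      have hb := M.abs_coeff_le tail hLS (fun e he => (htail e he).1) fun e he e' he' h =>
        eq_of_degreeIn_eq_one (htail e he).2 (hLS he) he' (htail e he).1 h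
      have hc := two_mul_card_vertexSet_le hLS
        (fun e he v hv h => mem_filter.2 ⟨he, v, hv, h⟩) hS
      have hcard := card_sdiff_add_card_eq_card hLS
      calc (n : ℝ) ^ (2 * (vertexSet S).card) * M.coeff S ^ 4
          ≤ (n : ℝ) ^ (3 * L.card + 2 * (S \ L).card) *
              (M.maxDegree ^ L.card * M.maxEntry ^ (S \ L).card) ^ 4 := by
            refine mul_le_mul (pow_le_pow_right₀ hn1 hc) ?_ (by positivity) (by positivity)
            rw [← Even.pow_abs (by decide : Even 4)]
            exact pow_le_pow_left₀ (abs_nonneg _) hb 4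
        _ = ((n : ℝ) ^ 3 * M.maxDegree ^ 4) ^ L.card *
              (n * M.maxEntry ^ 2) ^ (2 * (S \ L).card) := by ring
        _ ≤ K ^ L.card * K ^ (2 * (S \ L).card) := by
            have := M.maxDegree_nonneg
            have := M.maxEntry_nonneg
            gcongr
        _ = K ^ (L.card + 2 * (S \ L).card) := (pow_add _ _ _).symm
        _ ≤ K ^ (4 * S.card) := pow_le_pow_right₀ hK (by omega)
    -- An isolated edge splits off as an independent factor.
    · push Not at hS
      obtain ⟨e, he, hdeg⟩ := hS
      have hdisj : Disjoint (vertexSet {e}) (vertexSet (S.erase e)) := by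
        rw [disjoint_left]
        intro v hv hv'
        have hv : v ∈ ends e := by simpa [vertexSet] using hv
        obtain ⟨e', he', hv'⟩ := mem_vertexSet.1 hv'
        exact ne_of_mem_erase he'
          (eq_of_degreeIn_eq_one (hdeg v hv) (mem_of_mem_erase he') he hv' hv)
      have hSe : S = {e} ∪ S.erase e := by
        rw [← insert_eq, insert_erase he]
      have hcard : S.card = (S.erase e).card + 1 := (card_erase_add_one he).symm
      have hV : (vertexSet S).card = 2 + (vertexSet (S.erase e)).card := by
        conv_lhs => rw [hSe]
        rw [← insert_eq, vertexSet_insert, card_union_of_disjoint, card_ends]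
        simpa [vertexSet] using hdisj
      have hih := ih _ (by omega) (S.erase e) rfl
      have hco : M.coeff S = M.meanDegree * M.coeff (S.erase e) := by
        conv_lhs => rw [hSe]
        rw [M.coeff_union hdisj, M.coeff_singleton]
      calc (n : ℝ) ^ (2 * (vertexSet S).card) * M.coeff S ^ 4
          = (n * |M.meanDegree|) ^ 4 *
              ((n : ℝ) ^ (2 * (vertexSet (S.erase e)).card) * M.coeff (S.erase e) ^ 4) := by
            rw [hV, hco, mul_pow (n : ℝ), Even.pow_abs (by decide : Even 4)]
            ring
        _ ≤ K ^ 4 * K ^ (4 * (S.erase e).card) := by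
            gcongr
        _ = K ^ (4 * S.card) := by
            rw [hcard]
            ring

/-! ### Counting edge sets by their vertices -/

theorem card_filter_vertexSet_le {n : ℕ} (U : Finset (Fin n)) :
    (univ.filter fun S : Finset (Edge n) => vertexSet S ⊆ U).card ≤ 2 ^ U.card ^ 2 := by
  let E : Finset (Edge n) := univ.filter fun e => ends e ⊆ U
  have hE : E.card ≤ U.card ^ 2 := by
    rw [sq, ← card_product]
    refine card_le_card_of_injOn (fun e => e.1) (fun e he => ?_) Subtype.val_injective.injOn
    have he := (mem_filter.1 he).2
    exact mem_product.2 ⟨he (mem_ends.2 (Or.inl rfl)), he (mem_ends.2 (Or.inr rfl))⟩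
  refine (card_le_card (t := E.powerset) fun S hS => ?_).trans ?_
  · rw [mem_powerset]
    exact fun e he => mem_filter.2 ⟨mem_univ _,
      (ends_subset_vertexSet he).trans (mem_filter.1 hS).2⟩
  · rw [card_powerset]
    exact Nat.pow_le_pow_right two_pos hE

/-- The constant bounding the number of pairs of edge sets covering at most `r` vertices, when such
pairs on `u` vertices have weight `n ^ (-u)`. -/
def pairConst (r : ℕ) : ℝ := ∑ u ∈ range (r + 1), (2 : ℝ) ^ (2 * u ^ 2)

theorem pairConst_pos (r : ℕ) : 0 < pairConst r :=
  sum_pos (fun _ _ => by positivity) ⟨0, by simp⟩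

/-- If each pair of edge sets in `P` covers some `u ≤ r` vertices and has weight at most
`B / n ^ u`, then the total weight is at most a constant multiple of `B`. -/
theorem sum_pairs_le {n r : ℕ} (P : Finset (Finset (Edge n) × Finset (Edge n)))
    (w : Finset (Edge n) × Finset (Edge n) → ℝ) {B : ℝ} (hB : 0 ≤ B)
    (hr : ∀ z ∈ P, (vertexSet z.1 ∪ vertexSet z.2).card ≤ r)
    (hw : ∀ z ∈ P, (n : ℝ) ^ (vertexSet z.1 ∪ vertexSet z.2).card * w z ≤ B) :
    ∑ z ∈ P, w z ≤ pairConst r * B := by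
  rcases Nat.eq_zero_or_pos n with rfl | hn
  · have h0 : ∀ z : Finset (Edge 0) × Finset (Edge 0), z = (∅, ∅) := fun z => by
      apply Prod.ext <;> exact eq_empty_of_forall_notMem fun e => e.1.1.elim0
    have hle : ∑ z ∈ P, w z ≤ ∑ z ∈ ({(∅, ∅)} : Finset (Finset (Edge 0) × Finset (Edge 0))), B := by
      refine (sum_le_sum (g := fun _ => B) fun z hz => ?_).trans
        (sum_le_sum_of_subset_of_nonneg (fun z _ => mem_singleton.2 (h0 z)) fun _ _ _ => hB)
      have := hw z hz
      rw [h0 z] at this ⊢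
      simpa [vertexSet] using this
    rw [sum_singleton] at hle
    refine hle.trans (le_mul_of_one_le_left hB ?_)
    refine le_trans (by norm_num) (single_le_sum (f := fun u => (2 : ℝ) ^ (2 * u ^ 2))
      (fun _ _ => by positivity) (mem_range.2 (Nat.succ_pos r)))
  have hn0 : (0 : ℝ) < n := by exact_mod_cast hn
  let V : Finset (Edge n) × Finset (Edge n) → Finset (Fin n) :=
    fun z => vertexSet z.1 ∪ vertexSet z.2
  let 𝒰 : Finset (Finset (Fin n)) := univ.filter fun U => U.card ≤ r
  have hV : ∀ z ∈ P, V z ∈ 𝒰 := fun z hz => mem_filter.2 ⟨mem_univ _, hr z hz⟩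
  calc ∑ z ∈ P, w z = ∑ U ∈ 𝒰, ∑ z ∈ P with V z = U, w z := (sum_fiberwise_of_maps_to hV _).symm
    _ ≤ ∑ U ∈ 𝒰, (2 : ℝ) ^ (2 * U.card ^ 2) * (B / (n : ℝ) ^ U.card) := by
        refine sum_le_sum fun U _ => ?_
        calc ∑ z ∈ P with V z = U, w z ≤ ∑ z ∈ P with V z = U, B / (n : ℝ) ^ U.card := by
              refine sum_le_sum fun z hz => ?_
              obtain ⟨hzP, rfl⟩ := mem_filter.1 hz
              rw [le_div_iff₀' (by positivity)]
              exact hw z hzP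
          _ = ((P.filter fun z => V z = U).card : ℝ) * (B / (n : ℝ) ^ U.card) := by
              rw [sum_const, nsmul_eq_mul]
          _ ≤ _ := by
              refine mul_le_mul_of_nonneg_right ?_ (by positivity)
              let 𝒯 := univ.filter fun S : Finset (Edge n) => vertexSet S ⊆ U
              have : (P.filter fun z => V z = U).card ≤ (𝒯 ×ˢ 𝒯).card := by
                refine card_le_card fun z hz => ?_
                obtain ⟨_, rfl⟩ := mem_filter.1 hz
                exact mem_product.2 ⟨mem_filter.2 ⟨mem_univ _, subset_union_left⟩,
                  mem_filter.2 ⟨mem_univ _, subset_union_right⟩⟩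
              have h2 : (P.filter fun z => V z = U).card ≤ 2 ^ (2 * U.card ^ 2) := by
                refine this.trans ?_
                rw [card_product, two_mul, pow_add]
                exact Nat.mul_le_mul (card_filter_vertexSet_le U) (card_filter_vertexSet_le U)
              exact_mod_cast h2
    _ = ∑ u ∈ range (r + 1), ∑ U ∈ 𝒰 with U.card = u,
          (2 : ℝ) ^ (2 * U.card ^ 2) * (B / (n : ℝ) ^ U.card) :=
        (sum_fiberwise_of_maps_to (fun U hU => mem_range.2
          (Nat.lt_succ_of_le (mem_filter.1 hU).2)) _).symm
    _ ≤ ∑ u ∈ range (r + 1), (2 : ℝ) ^ (2 * u ^ 2) * B := by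
        refine sum_le_sum fun u _ => ?_
        calc ∑ U ∈ 𝒰 with U.card = u, (2 : ℝ) ^ (2 * U.card ^ 2) * (B / (n : ℝ) ^ U.card)
            = ∑ U ∈ 𝒰 with U.card = u, (2 : ℝ) ^ (2 * u ^ 2) * (B / (n : ℝ) ^ u) :=
              sum_congr rfl fun U hU => by rw [(mem_filter.1 hU).2]
          _ = ((𝒰.filter fun U => U.card = u).card : ℝ) *
                ((2 : ℝ) ^ (2 * u ^ 2) * (B / (n : ℝ) ^ u)) := by rw [sum_const, nsmul_eq_mul]
          _ ≤ (n : ℝ) ^ u * ((2 : ℝ) ^ (2 * u ^ 2) * (B / (n : ℝ) ^ u)) := by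
              refine mul_le_mul_of_nonneg_right ?_ (by positivity)
              have h1 : (𝒰.filter fun U => U.card = u).card ≤ n ^ u := by
                refine (card_le_card (t := powersetCard u univ) fun U hU =>
                  mem_powersetCard.2 ⟨subset_univ _, (mem_filter.1 hU).2⟩).trans ?_
                rw [card_powersetCard, card_univ, Fintype.card_fin]
                exact Nat.choose_le_pow n u
              exact_mod_cast h1
          _ = (2 : ℝ) ^ (2 * u ^ 2) * B := by field_simp
    _ = pairConst r * B := by rw [pairConst, sum_mul]

/-- Below all three detection thresholds, the Fourier mass on each bounded degree is bounded. -/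
theorem SBM.sum_coeff_sq_le {k n : ℕ} (M : SBM k) {K : ℝ} (hK : 1 ≤ K)
    (h1 : n * |M.meanDegree| ≤ K) (h2 : (n : ℝ) ^ 3 * M.maxDegree ^ 4 ≤ K)
    (h3 : n * M.maxEntry ^ 2 ≤ K) (D : ℕ) :
    ∑ S : Finset (Edge n) with S.card ≤ D ∧ S ≠ ∅, M.coeff S ^ 2 ≤
      pairConst (2 * D) * K ^ (2 * D) := by
  let 𝒮 : Finset (Finset (Edge n)) := univ.filter fun S => S.card ≤ D ∧ S ≠ ∅
  have hdiag : ∑ S ∈ 𝒮, M.coeff S ^ 2 =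
      ∑ z ∈ 𝒮.image fun S => (S, S), M.coeff z.1 ^ 2 := by
    rw [sum_image fun S _ T _ h => congrArg Prod.fst h]
  change ∑ S ∈ 𝒮, M.coeff S ^ 2 ≤ _
  rw [hdiag]
  refine sum_pairs_le _ _ (by positivity) ?_ ?_
  · intro z hz
    obtain ⟨S, hS, rfl⟩ := mem_image.1 hz
    have hS := (mem_filter.1 hS).2.1
    rw [union_self]
    refine card_biUnion_le.trans ?_
    simp only [card_ends, sum_const, smul_eq_mul]
    omega
  · intro z hz
    obtain ⟨S, hS, rfl⟩ := mem_image.1 hz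
    have hS := (mem_filter.1 hS).2.1
    rw [union_self]
    refine le_of_sq_le_sq ?_ (by positivity)
    calc ((n : ℝ) ^ (vertexSet S).card * M.coeff S ^ 2) ^ 2
        = (n : ℝ) ^ (2 * (vertexSet S).card) * M.coeff S ^ 4 := by ring
      _ ≤ K ^ (4 * S.card) := M.pow_mul_coeff_le hK h1 h2 h3 S
      _ ≤ K ^ (4 * D) := pow_le_pow_right₀ hK (by omega)
      _ = (K ^ (2 * D)) ^ 2 := by ring

/-! ### Copies of a graph -/

theorem ends_injective {n : ℕ} : Function.Injective (ends : Edge n → Finset (Fin n)) := by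
  intro e e' h
  refine edge_ext e.2.ne (mem_ends.2 (Or.inl rfl)) (mem_ends.2 (Or.inr rfl)) ?_ ?_
  · rw [← h]; exact mem_ends.2 (Or.inl rfl)
  · rw [← h]; exact mem_ends.2 (Or.inr rfl)

theorem SBM.edgeMean_of_ends {k n : ℕ} (M : SBM k) (x : Fin n → Fin k) {e : Edge n} {u v : Fin n}
    (h : ends e = {u, v}) : M.edgeMean x e = M.Q (x u) (x v) := by
  have hu : u ∈ ends e := by simp [h]
  have hv : v ∈ ends e := by simp [h]
  have huv : u ≠ v := by
    rintro rfl
    simpa [h] using card_ends e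
  rw [M.edgeMean_eq x hv, ((eq_or_eq_otherEnd hu hv).resolve_left huv)]

/-- The embedding `φ` realises the edge set `S` as a copy of `H`. -/
def Realizes {V : Type*} (H : SimpleGraph V) {n : ℕ} (φ : V ↪ Fin n) (S : Finset (Edge n)) : Prop :=
  ∀ e : Edge n, e ∈ S ↔ ∃ a b, H.Adj a b ∧ ends e = {φ a, φ b}

theorem isCopy_iff {V : Type*} {H : SimpleGraph V} {n : ℕ} {S : Finset (Edge n)} :
    IsCopy H S ↔ ∃ φ : V ↪ Fin n, Realizes H φ S := by
  refine exists_congr fun φ => forall_congr' fun e => iff_congr Iff.rfl ⟨?_, ?_⟩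
  · rintro ⟨a, b, h, ha, hb⟩
    exact ⟨a, b, h, by rw [ha, hb]; rfl⟩
  · rintro ⟨a, b, h, he⟩
    have h1 : e.1.1 = φ a ∨ e.1.1 = φ b := by
      have := mem_ends.2 (Or.inl rfl : e.1.1 = e.1.1 ∨ _)
      simpa [he] using this
    have h2 : e.1.2 = φ a ∨ e.1.2 = φ b := by
      have := mem_ends.2 (Or.inr rfl : e.1.2 = e.1.1 ∨ e.1.2 = e.1.2)
      simpa [he] using this
    have hne := e.2.ne
    rcases h1 with h1 | h1 <;> rcases h2 with h2 | h2
    · exact (hne (h1.trans h2.symm)).elim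
    · exact ⟨a, b, h, h1.symm, h2.symm⟩
    · exact ⟨b, a, h.symm, h1.symm, h2.symm⟩
    · exact (hne (h1.trans h2.symm)).elim

theorem exists_ends_eq {n : ℕ} {u v : Fin n} (h : u ≠ v) : ∃ e : Edge n, ends e = {u, v} := by
  rcases lt_or_gt_of_ne h with h | h
  · exact ⟨⟨(u, v), h⟩, rfl⟩
  · exact ⟨⟨(v, u), h⟩, pair_comm _ _⟩

theorem Realizes.exists_edge {V : Type*} {H : SimpleGraph V} {n : ℕ} {φ : V ↪ Fin n}
    {S : Finset (Edge n)} (h : Realizes H φ S) {a b : V} (hab : H.Adj a b) :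
    ∃ e ∈ S, ends e = {φ a, φ b} := by
  obtain ⟨e, he⟩ := exists_ends_eq (φ.injective.ne hab.ne)
  exact ⟨e, (h e).2 ⟨a, b, hab, he⟩, he⟩

theorem Realizes.vertexSet_eq {V : Type*} [Fintype V] {H : SimpleGraph V}
    (hH : ∀ a, ∃ b, H.Adj a b) {n : ℕ} {φ : V ↪ Fin n} {S : Finset (Edge n)}
    (h : Realizes H φ S) : vertexSet S = univ.map φ := by
  ext v
  rw [mem_vertexSet, mem_map]
  constructor
  · rintro ⟨e, he, hv⟩
    obtain ⟨a, b, _, hab⟩ := (h e).1 he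
    rw [hab, mem_insert, mem_singleton] at hv
    rcases hv with rfl | rfl
    · exact ⟨a, mem_univ _, rfl⟩
    · exact ⟨b, mem_univ _, rfl⟩
  · rintro ⟨a, _, rfl⟩
    obtain ⟨b, hab⟩ := hH a
    obtain ⟨e, he, hab⟩ := h.exists_edge hab
    exact ⟨e, he, by simp [hab]⟩

theorem card_vertexSet_of_isCopy {v n : ℕ} {H : SimpleGraph (Fin v)} (hH : ∀ a, ∃ b, H.Adj a b)
    {S : Finset (Edge n)} (h : IsCopy H S) : (vertexSet S).card = v := by
  obtain ⟨φ, hφ⟩ := isCopy_iff.1 h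
  rw [hφ.vertexSet_eq hH, card_map, card_univ, Fintype.card_fin]

open Classical in
/-- The copies of `H` in the complete graph on `Fin n`. -/
noncomputable def copies {V : Type*} (H : SimpleGraph V) (n : ℕ) : Finset (Finset (Edge n)) :=
  univ.filter fun S => IsCopy H S

theorem mem_copies {V : Type*} {H : SimpleGraph V} {n : ℕ} {S : Finset (Edge n)} :
    S ∈ copies H n ↔ IsCopy H S := by simp [copies]

theorem signedCount_eq {V : Type*} (H : SimpleGraph V) (n : ℕ) :
    signedCount H n = fun G => ∑ S ∈ copies H n, 1 * character S G := by
  funext G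
  simp only [one_mul]
  rfl

/-- Every vertex set of the right size supports a copy. -/
theorem choose_le_card_copies {v : ℕ} {H : SimpleGraph (Fin v)} (hH : ∀ a, ∃ b, H.Adj a b)
    (n : ℕ) : n.choose v ≤ (copies H n).card := by
  classical
  have hex : ∀ U : Finset (Fin n), U ∈ powersetCard v univ →
      ∃ S ∈ copies H n, vertexSet S = U := by
    intro U hU
    have hc := (mem_powersetCard.1 hU).2
    let φ : Fin v ↪ Fin n := (U.orderEmbOfFin hc).toEmbedding
    let S : Finset (Edge n) := univ.filter fun e => ∃ a b, H.Adj a b ∧ ends e = {φ a, φ b}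
    have hS : Realizes H φ S := fun e => by simp [S]
    refine ⟨S, mem_copies.2 (isCopy_iff.2 ⟨φ, hS⟩), ?_⟩
    rw [hS.vertexSet_eq hH]
    ext x
    have hx : x ∈ Set.range (U.orderEmbOfFin hc) ↔ x ∈ U := by
      rw [range_orderEmbOfFin U hc, mem_coe]
    rw [mem_map, ← hx]
    simp only [mem_univ, true_and]
    rfl
  calc n.choose v = (powersetCard v (univ : Finset (Fin n))).card := by
        rw [card_powersetCard, card_univ, Fintype.card_fin]
    _ ≤ ((copies H n).image vertexSet).card := card_le_card fun U hU => by
        obtain ⟨S, hS, h⟩ := hex U hU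
        exact mem_image.2 ⟨S, hS, h⟩
    _ ≤ _ := card_image_le

theorem pow_le_mul_card_copies {v n : ℕ} {H : SimpleGraph (Fin v)} (hH : ∀ a, ∃ b, H.Adj a b)
    (hn : 2 * v ≤ n) : n ^ v ≤ 2 ^ v * v.factorial * (copies H n).card := by
  calc n ^ v ≤ (2 * (n + 1 - v)) ^ v := Nat.pow_le_pow_left (by omega) v
    _ = 2 ^ v * (n + 1 - v) ^ v := mul_pow _ _ _
    _ ≤ 2 ^ v * n.descFactorial v := Nat.mul_le_mul_left _ (Nat.pow_sub_le_descFactorial n v)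
    _ = 2 ^ v * v.factorial * n.choose v := by
        rw [Nat.descFactorial_eq_factorial_mul_choose, mul_assoc]
    _ ≤ _ := Nat.mul_le_mul_left _ (choose_le_card_copies hH n)

/-! ### The second moment of a signed count -/

/-- If overlapping pairs of copies of `H` have small Fourier coefficients compared with the squared
coefficient `t` of a single copy, then the signed count of `H` has a large mean in the block model
compared with both standard deviations. -/
theorem SBM.max_var_signedCount_le {k n v : ℕ} (M : SBM k) {H : SimpleGraph (Fin v)}
    (hH : ∀ a, ∃ b, H.Adj a b) (hv : 0 < v) (hn : 2 * v ≤ n) {t ε : ℝ} (hε : 0 ≤ ε) (ht0 : t ≠ 0)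
    (ht : ∀ S : Finset (Edge n), IsCopy H S → M.coeff S = t)
    (hpair : ∀ S T : Finset (Edge n), IsCopy H S → IsCopy H T →
      ¬ Disjoint (vertexSet S) (vertexSet T) →
      (n : ℝ) ^ (vertexSet S ∪ vertexSet T).card * |M.coeff (symmDiff S T)| ≤
        ε * ((n : ℝ) ^ v * t) ^ 2) :
    0 < (expect (M.mass n) (signedCount H n) -
        expect (erdosRenyiMass n) (signedCount H n)) ^ 2 ∧
    max (var (M.mass n) (signedCount H n)) (var (erdosRenyiMass n) (signedCount H n)) ≤
      pairConst (2 * v) * (2 ^ v * v.factorial) ^ 2 * ε *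
        (expect (M.mass n) (signedCount H n) -
          expect (erdosRenyiMass n) (signedCount H n)) ^ 2 := by
  have hcard : ∀ S ∈ copies H n, (vertexSet S).card = v := fun S hS =>
    card_vertexSet_of_isCopy hH (mem_copies.1 hS)
  have hne : ∀ S ∈ copies H n, S ≠ ∅ := by
    rintro S hS rfl
    have := hcard _ hS
    simp [vertexSet] at this
    omega
  have hfilter : (copies H n).filter (fun S => S ≠ ∅) = copies H n := filter_true_of_mem hne
  have hmean : expect (M.mass n) (signedCount H n) -
      expect (erdosRenyiMass n) (signedCount H n) = (copies H n).card * t := by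
    rw [signedCount_eq, M.expect_sub_expect (copies H n) fun _ => 1, hfilter,
      sum_congr rfl fun S hS => by rw [ht S (mem_copies.1 hS), one_mul], sum_const, nsmul_eq_mul]
  have hB : 0 ≤ ε * ((n : ℝ) ^ v * t) ^ 2 := by positivity
  have hunion : ∀ S ∈ copies H n, ∀ T ∈ copies H n,
      (vertexSet S ∪ vertexSet T).card ≤ 2 * v := fun S hS T hT => by
    refine (card_union_le _ _).trans ?_
    rw [hcard S hS, hcard T hT, two_mul]
  have hvar : var (M.mass n) (signedCount H n) ≤
      pairConst (2 * v) * (ε * ((n : ℝ) ^ v * t) ^ 2) := by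
    rw [signedCount_eq, M.var_sum_character (copies H n) fun _ => 1, ← sum_product']
    let P := (copies H n ×ˢ copies H n).filter
      fun z => ¬ Disjoint (vertexSet z.1) (vertexSet z.2)
    rw [← sum_subset (filter_subset _ _ : P ⊆ _)]
    · refine sum_pairs_le P _ hB ?_ ?_
      · intro z hz
        obtain ⟨hz, _⟩ := mem_filter.1 hz
        exact hunion _ (mem_product.1 hz).1 _ (mem_product.1 hz).2
      · intro z hz
        obtain ⟨hz, hd⟩ := mem_filter.1 hz
        obtain ⟨h1, h2⟩ := mem_product.1 hz
        rw [mem_copies] at h1 h2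
        refine le_trans (mul_le_mul_of_nonneg_left ?_ (by positivity)) (hpair _ _ h1 h2 hd)
        rw [ht _ h1, ht _ h2, one_mul, one_mul]
        have := le_abs_self (M.coeff (symmDiff z.1 z.2))
        have := mul_self_nonneg t
        linarith
    -- Copies without a common vertex are uncorrelated.
    · intro z hz hzP
      have hd : Disjoint (vertexSet z.1) (vertexSet z.2) := by
        by_contra h
        exact hzP (mem_filter.2 ⟨hz, h⟩)
      have hd' : Disjoint z.1 z.2 := by
        rw [disjoint_left] at hd ⊢
        exact fun e h1 h2 => hd (ends_subset_vertexSet h1 (mem_ends.2 (Or.inl rfl)))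
          (ends_subset_vertexSet h2 (mem_ends.2 (Or.inl rfl)))
      rw [hd'.symmDiff_eq_sup, sup_eq_union, M.coeff_union hd, sub_self, mul_zero]
  -- The null variance is the number of copies, a sum over the diagonal pairs.
  have hvar0 : var (erdosRenyiMass n) (signedCount H n) ≤
      pairConst (2 * v) * (ε * ((n : ℝ) ^ v * t) ^ 2) := by
    rw [signedCount_eq, var_erdosRenyi_sum_character (copies H n) fun _ => 1, hfilter,
      ← sum_image (s := copies H n) (g := fun S => (S, S)) (f := fun _ => (1 : ℝ) ^ 2)
        fun S _ T _ h => congrArg Prod.fst h]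
    refine sum_pairs_le _ _ hB ?_ ?_
    · intro z hz
      obtain ⟨S, hS, rfl⟩ := mem_image.1 hz
      exact hunion S hS S hS
    · intro z hz
      obtain ⟨S, hS, rfl⟩ := mem_image.1 hz
      have hd : ¬ Disjoint (vertexSet S) (vertexSet S) := by
        rw [disjoint_self_iff_empty, ← card_eq_zero, hcard S hS]
        omega
      have := hpair S S (mem_copies.1 hS) (mem_copies.1 hS) hd
      rw [symmDiff_self, bot_eq_empty, M.coeff_empty, abs_one] at this
      rwa [one_pow]
  have hcopies : (n : ℝ) ^ v ≤ 2 ^ v * v.factorial * (copies H n).card := by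
    exact_mod_cast pow_le_mul_card_copies hH hn
  have hn0 : (0 : ℝ) < n := by exact_mod_cast (by omega : 0 < n)
  have hpos : (0 : ℝ) < (copies H n).card := by
    have h1 : (0 : ℝ) < 2 ^ v * v.factorial * (copies H n).card :=
      lt_of_lt_of_le (by positivity) hcopies
    exact pos_of_mul_pos_right h1 (by positivity)
  rw [hmean]
  refine ⟨by positivity, (max_le hvar hvar0).trans ?_⟩
  have hp := pairConst_pos (2 * v)
  calc pairConst (2 * v) * (ε * ((n : ℝ) ^ v * t) ^ 2)
      = pairConst (2 * v) * ε * (((n : ℝ) ^ v) ^ 2 * t ^ 2) := by ring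
    _ ≤ pairConst (2 * v) * ε * ((2 ^ v * v.factorial * (copies H n).card) ^ 2 * t ^ 2) := by
        gcongr
    _ = _ := by ring

/-! ### Edges, wedges and 4-cycles -/

theorem exists_of_isCopy_edge {n : ℕ} {S : Finset (Edge n)}
    (h : IsCopy (SimpleGraph.starGraph (0 : Fin 2)) S) : ∃ e, S = {e} := by
  obtain ⟨φ, hφ⟩ := isCopy_iff.1 h
  obtain ⟨e, he, hee⟩ := hφ.exists_edge (show (SimpleGraph.starGraph (0 : Fin 2)).Adj 0 1 by decide)
  have hadj : ∀ a b, (SimpleGraph.starGraph (0 : Fin 2)).Adj a b →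
      (a = 0 ∧ b = 1) ∨ (a = 1 ∧ b = 0) := by decide
  refine ⟨e, ext fun f => ⟨fun hf => mem_singleton.2 (ends_injective ?_), fun hf => ?_⟩⟩
  · obtain ⟨a, b, hab, hfe⟩ := (hφ f).1 hf
    rcases hadj a b hab with ⟨rfl, rfl⟩ | ⟨rfl, rfl⟩
    · rw [hfe, hee]
    · rw [hfe, hee, pair_comm]
  · rwa [mem_singleton.1 hf]

theorem exists_of_isCopy_wedge {n : ℕ} {S : Finset (Edge n)}
    (h : IsCopy (SimpleGraph.starGraph (0 : Fin 3)) S) :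
    ∃ (u a b : Fin n) (e f : Edge n), u ≠ a ∧ u ≠ b ∧ a ≠ b ∧ ends e = {u, a} ∧ ends f = {u, b} ∧
      S = {e, f} := by
  obtain ⟨φ, hφ⟩ := isCopy_iff.1 h
  obtain ⟨e, he, hee⟩ := hφ.exists_edge (show (SimpleGraph.starGraph (0 : Fin 3)).Adj 0 1 by decide)
  obtain ⟨f, hf, hfe⟩ := hφ.exists_edge (show (SimpleGraph.starGraph (0 : Fin 3)).Adj 0 2 by decide)
  have hadj : ∀ a b, (SimpleGraph.starGraph (0 : Fin 3)).Adj a b →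
      (a = 0 ∧ b = 1) ∨ (a = 1 ∧ b = 0) ∨ (a = 0 ∧ b = 2) ∨ (a = 2 ∧ b = 0) := by decide
  refine ⟨φ 0, φ 1, φ 2, e, f, φ.injective.ne (by decide), φ.injective.ne (by decide),
    φ.injective.ne (by decide), hee, hfe, ext fun g => ⟨fun hg => ?_, fun hg => ?_⟩⟩
  · obtain ⟨a, b, hab, hge⟩ := (hφ g).1 hg
    rw [mem_insert, mem_singleton]
    rcases hadj a b hab with ⟨rfl, rfl⟩ | ⟨rfl, rfl⟩ | ⟨rfl, rfl⟩ | ⟨rfl, rfl⟩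
    · exact Or.inl (ends_injective (hge.trans hee.symm))
    · exact Or.inl (ends_injective ((hge.trans (pair_comm _ _)).trans hee.symm))
    · exact Or.inr (ends_injective (hge.trans hfe.symm))
    · exact Or.inr (ends_injective ((hge.trans (pair_comm _ _)).trans hfe.symm))
  · rw [mem_insert, mem_singleton] at hg
    rcases hg with rfl | rfl <;> assumption

theorem exists_of_isCopy_fourCycle {n : ℕ} {S : Finset (Edge n)}
    (h : IsCopy (SimpleGraph.cycleGraph 4) S) :
    ∃ (u : Fin 4 ↪ Fin n) (e : Fin 4 ↪ Edge n), (∀ i, ends (e i) = {u i, u (i + 1)}) ∧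
      S = univ.map e := by
  obtain ⟨φ, hφ⟩ := isCopy_iff.1 h
  have hadj : ∀ i : Fin 4, (SimpleGraph.cycleGraph 4).Adj i (i + 1) := by decide
  have hadj' : ∀ a b, (SimpleGraph.cycleGraph 4).Adj a b → b = a + 1 ∨ a = b + 1 := by decide
  choose e he hee using fun i => hφ.exists_edge (hadj i)
  have hinj : Function.Injective e := by
    intro i j hij
    have h1 : ({i, i + 1} : Finset (Fin 4)) = {j, j + 1} := by
      apply map_injective φ
      have := congrArg ends hij
      rw [hee, hee] at this
      simpa using this
    have key : ∀ i j : Fin 4, ({i, i + 1} : Finset (Fin 4)) = {j, j + 1} → i = j := by decide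
    exact key i j h1
  refine ⟨φ, ⟨e, hinj⟩, hee, ext fun g => ⟨fun hg => ?_, fun hg => ?_⟩⟩
  · obtain ⟨a, b, hab, hge⟩ := (hφ g).1 hg
    rw [mem_map]
    rcases hadj' a b hab with rfl | rfl
    · exact ⟨a, mem_univ _, ends_injective ((hee a).trans hge.symm)⟩
    · exact ⟨b, mem_univ _, ends_injective ((hee b).trans ((pair_comm _ _).trans hge.symm))⟩
  · obtain ⟨i, _, rfl⟩ := mem_map.1 hg
    exact he i

theorem degreeIn_fourCycle_le {n : ℕ} {S : Finset (Edge n)}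
    (h : IsCopy (SimpleGraph.cycleGraph 4) S) (v : Fin n) : degreeIn S v ≤ 2 := by
  obtain ⟨u, e, he, rfl⟩ := exists_of_isCopy_fourCycle h
  unfold degreeIn
  rw [filter_map, card_map]
  by_cases hv : ∃ i, u i = v
  · obtain ⟨i, rfl⟩ := hv
    have hi : ∀ i : Fin 4, (univ.filter fun j : Fin 4 => i = j ∨ i = j + 1).card ≤ 2 := by decide
    refine (card_le_card fun j hj => ?_).trans (hi i)
    have := (mem_filter.1 hj).2
    simpa [he] using this
  · rw [filter_false_of_mem]
    · simp
    · intro j _ hj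
      simp only [Function.comp, he, mem_insert, mem_singleton] at hj
      exact hj.elim (fun h => hv ⟨_, h.symm⟩) fun h => hv ⟨_, h.symm⟩

/-- The Fourier coefficient of a wedge. -/
noncomputable def SBM.wedgeMean {k : ℕ} (M : SBM k) : ℝ := ∑ a, M.p a * M.degree a ^ 2

/-- The Fourier coefficient of a 4-cycle. -/
noncomputable def SBM.cycleMean {k : ℕ} (M : SBM k) : ℝ :=
  ∑ a, M.p a * ∑ c, M.p c * (∑ b, M.p b * (M.Q a b * M.Q b c)) ^ 2

theorem SBM.coeff_edge {k n : ℕ} (M : SBM k) {S : Finset (Edge n)}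
    (h : IsCopy (SimpleGraph.starGraph (0 : Fin 2)) S) : M.coeff S = M.meanDegree := by
  obtain ⟨e, rfl⟩ := exists_of_isCopy_edge h
  exact M.coeff_singleton e

theorem SBM.coeff_wedge {k n : ℕ} (M : SBM k) {S : Finset (Edge n)}
    (h : IsCopy (SimpleGraph.starGraph (0 : Fin 3)) S) : M.coeff S = M.wedgeMean := by
  obtain ⟨u, a, b, e, f, hua, hub, hab, he, hf, rfl⟩ := exists_of_isCopy_wedge h
  have hef : e ≠ f := by
    rintro rfl
    have : b ∈ ends e := by simp [hf]
    rw [he, mem_insert, mem_singleton] at this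
    exact this.elim hub.symm hab.symm
  unfold SBM.coeff
  simp only [prod_pair hef, M.edgeMean_of_ends _ he, M.edgeMean_of_ends _ hf]
  rw [M.labelMean_resample a]
  simp only [Function.update_self, Function.update_of_ne hua, Function.update_of_ne hab.symm]
  rw [M.labelMean_resample b]
  simp only [Function.update_self, Function.update_of_ne hub]
  rw [M.labelMean_eval u fun c => ∑ y, M.p y * ∑ z, M.p z * (M.Q c z * M.Q c y)]
  refine sum_congr rfl fun c _ => ?_
  rw [sq, SBM.degree, sum_mul_sum]
  congr 1
  refine sum_congr rfl fun y _ => ?_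
  rw [mul_sum]
  exact sum_congr rfl fun z _ => by ring

theorem SBM.coeff_fourCycle {k n : ℕ} (M : SBM k) {S : Finset (Edge n)}
    (h : IsCopy (SimpleGraph.cycleGraph 4) S) : M.coeff S = M.cycleMean := by
  obtain ⟨u, e, he, rfl⟩ := exists_of_isCopy_fourCycle h
  have hne : ∀ i j : Fin 4, i ≠ j → u i ≠ u j := fun i j hij => u.injective.ne hij
  unfold SBM.coeff
  simp only [prod_map, Fin.prod_univ_four, M.edgeMean_of_ends _ (he _)]
  simp only [show (0 : Fin 4) + 1 = 1 from rfl, show (1 : Fin 4) + 1 = 2 from rfl,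
    show (2 : Fin 4) + 1 = 3 from rfl, show (3 : Fin 4) + 1 = 0 from rfl]
  rw [M.labelMean_resample (u 1)]
  simp only [Function.update_self, Function.update_of_ne (hne 0 1 (by decide)),
    Function.update_of_ne (hne 2 1 (by decide)), Function.update_of_ne (hne 3 1 (by decide))]
  rw [M.labelMean_resample (u 3)]
  simp only [Function.update_self, Function.update_of_ne (hne 0 3 (by decide)),
    Function.update_of_ne (hne 2 3 (by decide))]
  rw [M.labelMean_resample (u 2)]
  simp only [Function.update_self, Function.update_of_ne (hne 0 2 (by decide))]
  rw [M.labelMean_eval (u 0) fun a => ∑ c, M.p c * ∑ d, M.p d * ∑ b, M.p b *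
    (M.Q a b * M.Q b c * M.Q c d * M.Q d a)]
  refine sum_congr rfl fun a _ => ?_
  congr 1
  refine sum_congr rfl fun c _ => ?_
  rw [sq, sum_mul_sum]
  congr 1
  refine sum_congr rfl fun d _ => ?_
  rw [mul_sum]
  refine sum_congr rfl fun b _ => ?_
  rw [M.Q_symm.apply c d, M.Q_symm.apply d a]
  ring

theorem SBM.single_le_sum_p_mul {k : ℕ} (M : SBM k) {h : Fin k → ℝ} (hh : ∀ a, 0 ≤ h a)
    {c : ℝ} (hM : ∀ a, c ≤ M.p a) (a : Fin k) : c * h a ≤ ∑ b, M.p b * h b :=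
  (mul_le_mul_of_nonneg_right (hM a) (hh a)).trans
    (single_le_sum (f := fun b => M.p b * h b)
      (fun b _ => mul_nonneg (M.p_nonneg b) (hh b)) (mem_univ a))

theorem SBM.le_wedgeMean {k : ℕ} (M : SBM k) {c : ℝ} (hM : ∀ a, c ≤ M.p a) :
    c * M.maxDegree ^ 2 ≤ M.wedgeMean := by
  obtain ⟨a, ha⟩ := M.exists_abs_degree_eq
  rw [← ha, sq_abs]
  exact M.single_le_sum_p_mul (h := fun a => M.degree a ^ 2) (fun _ => sq_nonneg _) hM a

theorem SBM.le_cycleMean {k : ℕ} (M : SBM k) {c : ℝ} (hc : 0 < c) (hM : ∀ a, c ≤ M.p a) :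
    c ^ 4 * M.maxEntry ^ 4 ≤ M.cycleMean := by
  obtain ⟨a, b, hab⟩ := M.exists_abs_Q_eq
  have h1 : c * M.maxEntry ^ 2 ≤ ∑ y, M.p y * (M.Q a y * M.Q y a) := by
    have : c * (M.Q a b * M.Q b a) ≤ _ := M.single_le_sum_p_mul (h := fun y => M.Q a y * M.Q y a)
      (fun y => by rw [M.Q_symm.apply a y]; exact mul_self_nonneg _) hM b
    rwa [M.Q_symm.apply a b, ← sq, ← sq_abs, hab] at this
  have h2 := M.single_le_sum_p_mul (h := fun z => (∑ y, M.p y * (M.Q a y * M.Q y z)) ^ 2)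
    (fun _ => sq_nonneg _) hM a
  have h3 := M.single_le_sum_p_mul
    (h := fun x => ∑ z, M.p z * (∑ y, M.p y * (M.Q x y * M.Q y z)) ^ 2)
    (fun _ => sum_nonneg fun z _ => mul_nonneg (M.p_nonneg z) (sq_nonneg _)) hM a
  have h0 := M.maxEntry_nonneg
  calc c ^ 4 * M.maxEntry ^ 4 = c * (c * (c * M.maxEntry ^ 2) ^ 2) := by ring
    _ ≤ c * (c * (∑ y, M.p y * (M.Q a y * M.Q y a)) ^ 2) := by gcongr
    _ ≤ _ := (mul_le_mul_of_nonneg_left h2 hc.le).trans h3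

/-! ### Overlapping pairs of copies -/

/-- Two distinct edges each have a private endpoint. -/
theorem SBM.abs_coeff_le_of_card_eq_two {k n : ℕ} (M : SBM k) {S : Finset (Edge n)}
    (hS : S.card = 2) : |M.coeff S| ≤ M.maxDegree ^ 2 := by
  obtain ⟨e, f, hef, rfl⟩ := card_eq_two.1 hS
  have key : ∀ e f : Edge n, e ≠ f → ∃ v ∈ ends e, v ∉ ends f := by
    intro e f hef
    by_contra! h
    exact hef (ends_injective (eq_of_subset_of_card_le h (by rw [card_ends, card_ends])))
  obtain ⟨v, hv, hv'⟩ := key e f hef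
  obtain ⟨w, hw, hw'⟩ := key f e hef.symm
  have := M.abs_coeff_le (fun g => if g = e then v else w) (Subset.refl {e, f})
    (by simp [hef.symm, hv, hw]) (by simp [hef.symm, hv', hw'])
  simpa [card_pair hef] using this

theorem card_union_add_card_inter_vertexSet {v n : ℕ} {H : SimpleGraph (Fin v)}
    (hH : ∀ a, ∃ b, H.Adj a b) {S T : Finset (Edge n)} (hS : IsCopy H S) (hT : IsCopy H T) :
    (vertexSet S ∪ vertexSet T).card + (vertexSet S ∩ vertexSet T).card = 2 * v := by
  rw [card_union_add_card_inter, card_vertexSet_of_isCopy hH hS, card_vertexSet_of_isCopy hH hT,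
    two_mul]

theorem card_symmDiff_add {α : Type*} [DecidableEq α] (S T : Finset α) :
    (symmDiff S T).card + 2 * (S ∩ T).card = S.card + T.card := by
  have h1 := card_sdiff_add_card_inter S T
  have h2 := card_sdiff_add_card_inter T S
  have h3 : (symmDiff S T).card = (S \ T).card + (T \ S).card := by
    rw [symmDiff_def, sup_eq_union, card_union_of_disjoint disjoint_sdiff_sdiff]
  rw [inter_comm T S] at h2
  omega

theorem vertexSet_inter_subset {n : ℕ} (S T : Finset (Edge n)) :
    vertexSet (S ∩ T) ⊆ vertexSet S ∩ vertexSet T := fun v hv => by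
  obtain ⟨e, he, hv⟩ := mem_vertexSet.1 hv
  rw [mem_inter] at he
  exact mem_inter.2 ⟨ends_subset_vertexSet he.1 hv, ends_subset_vertexSet he.2 hv⟩

theorem card_inter_pos_of_not_disjoint {n : ℕ} {S T : Finset (Edge n)}
    (h : ¬ Disjoint (vertexSet S) (vertexSet T)) : 0 < (vertexSet S ∩ vertexSet T).card := by
  rwa [card_pos, nonempty_iff_ne_empty, ne_eq, ← disjoint_iff_inter_eq_empty]

/-- Above the threshold of the edge, pairs of overlapping edges contribute little to the
variance. -/
theorem edge_pair_bound {k n : ℕ} (M : SBM k) {K : ℝ} (hK : 1 ≤ K)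
    (h1 : K ≤ n * |M.meanDegree|) (h2 : K * M.maxDegree ^ 2 ≤ n * M.meanDegree ^ 2)
    {S T : Finset (Edge n)} (hS : IsCopy (SimpleGraph.starGraph (0 : Fin 2)) S)
    (hT : IsCopy (SimpleGraph.starGraph (0 : Fin 2)) T)
    (hd : ¬ Disjoint (vertexSet S) (vertexSet T)) :
    K * ((n : ℝ) ^ (vertexSet S ∪ vertexSet T).card * |M.coeff (symmDiff S T)|) ≤
      ((n : ℝ) ^ 2 * M.meanDegree) ^ 2 := by
  have hu := card_union_add_card_inter_vertexSet (by decide) hS hT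
  have hi := card_inter_pos_of_not_disjoint hd
  by_cases hST : S = T
  · subst hST
    rw [inter_self, card_vertexSet_of_isCopy (by decide) hS] at hu
    rw [symmDiff_self, bot_eq_empty, M.coeff_empty, abs_one,
      show (vertexSet S ∪ vertexSet S).card = 2 by omega]
    calc K * ((n : ℝ) ^ 2 * 1) ≤ K ^ 2 * (n : ℝ) ^ 2 := by
          rw [mul_one]
          exact mul_le_mul_of_nonneg_right (le_self_pow₀ hK two_ne_zero) (by positivity)
      _ ≤ (n * |M.meanDegree|) ^ 2 * (n : ℝ) ^ 2 := by gcongr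
      _ = _ := by rw [mul_pow, sq_abs]; ring
  · obtain ⟨e, rfl⟩ := exists_of_isCopy_edge hS
    obtain ⟨f, rfl⟩ := exists_of_isCopy_edge hT
    have hef : e ≠ f := fun h => hST (by rw [h])
    have hc : (symmDiff {e} {f} : Finset (Edge n)).card = 2 := by
      have := card_symmDiff_add ({e} : Finset (Edge n)) {f}
      rw [singleton_inter_of_notMem (by simpa using hef)] at this
      simpa using this
    have hn : 1 ≤ (n : ℝ) := by exact_mod_cast e.1.1.pos
    calc K * ((n : ℝ) ^ (vertexSet {e} ∪ vertexSet {f}).card * |M.coeff (symmDiff {e} {f})|)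
        ≤ K * ((n : ℝ) ^ 3 * M.maxDegree ^ 2) := by
          gcongr
          · omega
          · exact M.abs_coeff_le_of_card_eq_two hc
      _ = (n : ℝ) ^ 3 * (K * M.maxDegree ^ 2) := by ring
      _ ≤ (n : ℝ) ^ 3 * (n * M.meanDegree ^ 2) := by gcongr
      _ = _ := by ring

theorem card_wedge {n : ℕ} {S : Finset (Edge n)}
    (hS : IsCopy (SimpleGraph.starGraph (0 : Fin 3)) S) : S.card = 2 := by
  obtain ⟨u, a, b, e, f, hua, hub, hab, he, hf, rfl⟩ := exists_of_isCopy_wedge hS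
  refine card_pair fun h => ?_
  have : b ∈ ends e := by simp [h, hf]
  rw [he, mem_insert, mem_singleton] at this
  exact this.elim hub.symm hab.symm

/-- Two wedges that share exactly one vertex each have a leaf outside the other. -/
theorem abs_coeff_union_wedge_le {k n : ℕ} (M : SBM k) {S T : Finset (Edge n)}
    (hS : IsCopy (SimpleGraph.starGraph (0 : Fin 3)) S)
    (hT : IsCopy (SimpleGraph.starGraph (0 : Fin 3)) T) (hST : (S ∪ T).card = 4)
    (hi : (vertexSet S ∩ vertexSet T).card ≤ 1) :
    |M.coeff (S ∪ T)| ≤ M.maxDegree ^ 2 * M.maxEntry ^ 2 := by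
  have key : ∀ {S T : Finset (Edge n)}, IsCopy (SimpleGraph.starGraph (0 : Fin 3)) S →
      (vertexSet S ∩ vertexSet T).card ≤ 1 →
      ∃ e ∈ S, ∃ v ∈ ends e, ∀ g ∈ S ∪ T, v ∈ ends g → e = g := by
    intro S T hS hi
    obtain ⟨u, a, b, e, f, hua, hub, hab, he, hf, rfl⟩ := exists_of_isCopy_wedge hS
    by_cases ha : a ∈ vertexSet T
    · have hb : b ∉ vertexSet T := fun hb => hab (card_le_one.1 hi a
        (mem_inter.2 ⟨mem_vertexSet.2 ⟨e, by simp, by simp [he]⟩, ha⟩) b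
        (mem_inter.2 ⟨mem_vertexSet.2 ⟨f, by simp, by simp [hf]⟩, hb⟩))
      refine ⟨f, by simp, b, by simp [hf], fun g hg hbg => ?_⟩
      rcases mem_union.1 hg with hg | hg
      · rw [mem_insert, mem_singleton] at hg
        rcases hg with rfl | rfl
        · rw [he, mem_insert, mem_singleton] at hbg
          exact (hbg.elim hub.symm hab.symm).elim
        · rfl
      · exact (hb (mem_vertexSet.2 ⟨g, hg, hbg⟩)).elim
    · refine ⟨e, by simp, a, by simp [he], fun g hg hag => ?_⟩
      rcases mem_union.1 hg with hg | hg
      · rw [mem_insert, mem_singleton] at hg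
        rcases hg with rfl | rfl
        · rfl
        · rw [hf, mem_insert, mem_singleton] at hag
          exact (hag.elim hua.symm hab).elim
      · exact (ha (mem_vertexSet.2 ⟨g, hg, hag⟩)).elim
  obtain ⟨e, he, v, hv, hve⟩ := key hS hi
  obtain ⟨f, hf, w, hw, hwf⟩ := key hT (by rwa [inter_comm])
  have hSc := card_wedge hS
  have hTc := card_wedge hT
  have hef : e ≠ f := by
    rintro rfl
    have := card_union_add_card_inter S T
    have := card_pos.2 ⟨e, mem_inter.2 ⟨he, hf⟩⟩
    omega
  have hsub : {e, f} ⊆ S ∪ T := insert_subset (mem_union_left _ he)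
    (singleton_subset_iff.2 (mem_union_right _ hf))
  have hcard : ((S ∪ T) \ {e, f}).card = 2 := by
    rw [card_sdiff_of_subset hsub, card_pair hef, hST]
  have := M.abs_coeff_le (fun g => if g = e then v else w) hsub
    (by simp [hef.symm, hv, hw]) (by
      intro g hg g' hg'
      rw [mem_insert, mem_singleton] at hg
      rcases hg with rfl | rfl
      · simpa using hve g' hg'
      · simpa [hef.symm] using hwf g' (by rwa [union_comm]))
  rwa [card_pair hef, hcard] at this

/-- Above the threshold of the wedge, pairs of overlapping wedges contribute little to the
variance. The critical pairs share exactly one leaf, or form a 4-cycle. -/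
theorem wedge_pair_bound {k n : ℕ} (M : SBM k) {K : ℝ} (hK : 1 ≤ K)
    (h1 : K ^ 3 ≤ (n : ℝ) ^ 3 * M.maxDegree ^ 4) (h2 : K * M.maxEntry ^ 2 ≤ n * M.maxDegree ^ 2)
    {S T : Finset (Edge n)} (hS : IsCopy (SimpleGraph.starGraph (0 : Fin 3)) S)
    (hT : IsCopy (SimpleGraph.starGraph (0 : Fin 3)) T)
    (hd : ¬ Disjoint (vertexSet S) (vertexSet T)) :
    K * ((n : ℝ) ^ (vertexSet S ∪ vertexSet T).card * |M.coeff (symmDiff S T)|) ≤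
      (n : ℝ) ^ 6 * M.maxDegree ^ 4 := by
  have hu := card_union_add_card_inter_vertexSet (by decide) hS hT
  have hi := card_inter_pos_of_not_disjoint hd
  have hsd := card_symmDiff_add S T
  rw [card_wedge hS, card_wedge hT] at hsd
  have hn : 1 ≤ (n : ℝ) := by
    obtain ⟨v, _⟩ := card_pos.1 hi
    exact_mod_cast v.pos
  have hδ := M.maxDegree_nonneg
  have hq := M.maxEntry_nonneg
  have hs2 : (S ∩ T).card ≤ 2 := (card_le_card inter_subset_left).trans (card_wedge hS).le
  interval_cases hs : (S ∩ T).card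
  -- No common edge.
  · have hST : symmDiff S T = S ∪ T := by
      rw [card_eq_zero, ← disjoint_iff_inter_eq_empty] at hs
      rw [hs.symmDiff_eq_sup, sup_eq_union]
    rcases (by omega : (vertexSet S ∩ vertexSet T).card ≤ 1 ∨
      2 ≤ (vertexSet S ∩ vertexSet T).card) with hi' | hi'
    · have hb := abs_coeff_union_wedge_le M hS hT (by rw [← hST]; omega) hi'
      rw [hST, show (vertexSet S ∪ vertexSet T).card = 5 by omega]
      calc K * ((n : ℝ) ^ 5 * |M.coeff (S ∪ T)|)
          ≤ K * ((n : ℝ) ^ 5 * (M.maxDegree ^ 2 * M.maxEntry ^ 2)) := by gcongr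
        _ = (n : ℝ) ^ 5 * M.maxDegree ^ 2 * (K * M.maxEntry ^ 2) := by ring
        _ ≤ (n : ℝ) ^ 5 * M.maxDegree ^ 2 * (n * M.maxDegree ^ 2) := by gcongr
        _ = _ := by ring
    · have hb := M.abs_coeff_le_maxEntry (symmDiff S T)
      rw [show (symmDiff S T).card = 4 by omega] at hb
      calc K * ((n : ℝ) ^ (vertexSet S ∪ vertexSet T).card * |M.coeff (symmDiff S T)|)
          ≤ K * ((n : ℝ) ^ 4 * M.maxEntry ^ 4) := by
            gcongr
            omega
        _ ≤ K ^ 2 * ((n : ℝ) ^ 4 * M.maxEntry ^ 4) := by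
            gcongr
            exact le_self_pow₀ hK two_ne_zero
        _ = (n : ℝ) ^ 4 * (K * M.maxEntry ^ 2) ^ 2 := by ring
        _ ≤ (n : ℝ) ^ 4 * (n * M.maxDegree ^ 2) ^ 2 := by gcongr
        _ = _ := by ring
  -- One common edge, hence two common vertices.
  · have hb := M.abs_coeff_le_of_card_eq_two (S := symmDiff S T) (by omega)
    have hi2 : 2 ≤ (vertexSet S ∩ vertexSet T).card := by
      obtain ⟨e, he⟩ := card_pos.1 (by omega : 0 < (S ∩ T).card)
      rw [← card_ends e]
      exact card_le_card ((ends_subset_vertexSet he).trans (vertexSet_inter_subset S T))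
    have h3 : K ≤ (n : ℝ) ^ 2 * M.maxDegree ^ 2 := by
      refine le_of_sq_le_sq ?_ (by positivity)
      calc K ^ 2 ≤ K ^ 3 := pow_le_pow_right₀ hK (by omega)
        _ ≤ (n : ℝ) ^ 3 * M.maxDegree ^ 4 := h1
        _ ≤ (n : ℝ) ^ 4 * M.maxDegree ^ 4 := by gcongr; omega
        _ = _ := by ring
    calc K * ((n : ℝ) ^ (vertexSet S ∪ vertexSet T).card * |M.coeff (symmDiff S T)|)
        ≤ (n : ℝ) ^ 2 * M.maxDegree ^ 2 * ((n : ℝ) ^ 4 * M.maxDegree ^ 2) := by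
          gcongr
          omega
      _ = _ := by ring
  -- Equal wedges.
  · have hST : symmDiff S T = ∅ := card_eq_zero.1 (by omega)
    have hST' : S = T := symmDiff_eq_bot.1 hST
    rw [hST, M.coeff_empty, abs_one, mul_one]
    rw [← hST', inter_self, card_vertexSet_of_isCopy (by decide) hS] at hu
    rw [← hST', show (vertexSet S ∪ vertexSet S).card = 3 by omega]
    calc K * (n : ℝ) ^ 3 ≤ K ^ 3 * (n : ℝ) ^ 3 := by
          gcongr
          exact le_self_pow₀ hK (by omega)
      _ ≤ (n : ℝ) ^ 3 * M.maxDegree ^ 4 * (n : ℝ) ^ 3 := by gcongr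
      _ = _ := by ring

/-- Above the threshold of the 4-cycle, pairs of overlapping 4-cycles contribute little to the
variance: they have at least as many common vertices as common edges. -/
theorem fourCycle_pair_bound {k n : ℕ} (M : SBM k) {K : ℝ} (hK : 1 ≤ K)
    (h1 : K ≤ n * M.maxEntry ^ 2)
    {S T : Finset (Edge n)} (hS : IsCopy (SimpleGraph.cycleGraph 4) S)
    (hT : IsCopy (SimpleGraph.cycleGraph 4) T)
    (hd : ¬ Disjoint (vertexSet S) (vertexSet T)) :
    K * ((n : ℝ) ^ (vertexSet S ∪ vertexSet T).card * |M.coeff (symmDiff S T)|) ≤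
      (n : ℝ) ^ 8 * M.maxEntry ^ 8 := by
  have hu := card_union_add_card_inter_vertexSet (by decide) hS hT
  have hi := card_inter_pos_of_not_disjoint hd
  have hcard : ∀ {S : Finset (Edge n)}, IsCopy (SimpleGraph.cycleGraph 4) S → S.card = 4 := by
    intro S hS
    obtain ⟨u, e, _, rfl⟩ := exists_of_isCopy_fourCycle hS
    simp
  have hsd := card_symmDiff_add S T
  rw [hcard hS, hcard hT] at hsd
  -- Every shared vertex lies on at most two shared edges.
  have hshare : (S ∩ T).card ≤ (vertexSet S ∩ vertexSet T).card := by
    have h2 := sum_vertexSet (S ∩ T) fun _ => 1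
    simp only [mul_one, sum_const, card_ends, smul_eq_mul] at h2
    have h3 : ∑ v ∈ vertexSet (S ∩ T), degreeIn (S ∩ T) v ≤ (vertexSet (S ∩ T)).card * 2 := by
      rw [← smul_eq_mul, ← sum_const]
      refine sum_le_sum fun v _ => le_trans ?_ (degreeIn_fourCycle_le hS v)
      exact card_le_card (filter_subset_filter _ inter_subset_left)
    have h4 := card_le_card (vertexSet_inter_subset S T)
    omega
  have hq := M.maxEntry_nonneg
  have hKn : K ≤ n := h1.trans (mul_le_of_le_one_right (by positivity)
    (pow_le_one₀ hq M.maxEntry_le_one))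
  obtain ⟨r, hr⟩ := Nat.exists_eq_add_of_le hshare
  have hb := M.abs_coeff_le_maxEntry (symmDiff S T)
  calc K * ((n : ℝ) ^ (vertexSet S ∪ vertexSet T).card * |M.coeff (symmDiff S T)|)
      ≤ K ^ (r + (S ∩ T).card) *
          ((n : ℝ) ^ (vertexSet S ∪ vertexSet T).card * M.maxEntry ^ (symmDiff S T).card) := by
        gcongr
        exact le_self_pow₀ hK (by omega)
    _ = K ^ r * K ^ (S ∩ T).card *
          ((n : ℝ) ^ (vertexSet S ∪ vertexSet T).card * M.maxEntry ^ (symmDiff S T).card) := by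
        rw [pow_add]
    _ ≤ (n : ℝ) ^ r * (n * M.maxEntry ^ 2) ^ (S ∩ T).card *
          ((n : ℝ) ^ (vertexSet S ∪ vertexSet T).card * M.maxEntry ^ (symmDiff S T).card) := by
        gcongr
    _ = (n : ℝ) ^ (r + (S ∩ T).card + (vertexSet S ∪ vertexSet T).card) *
          M.maxEntry ^ ((symmDiff S T).card + 2 * (S ∩ T).card) := by ring
    _ = _ := by
        congr 2
        omega

/-! ### Choosing the pattern -/

/-- The detection rate of a pattern: its signed count separates the block model from `G(n, 1/2)`
as soon as `n` is large compared with the inverse of the rate. -/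
noncomputable def Pattern.rate {k : ℕ} (M : SBM k) : Pattern → ℝ
  | .edge => min |M.meanDegree| ((M.meanDegree / M.maxDegree) ^ 2)
  | .wedge => min (M.maxDegree ^ (4 / 3 : ℝ)) ((M.maxDegree / M.maxEntry) ^ 2)
  | .fourCycle => M.maxEntry ^ 2

theorem Pattern.exists_rate_max {k : ℕ} (M : SBM k) :
    ∃ H : Pattern, ∀ H' : Pattern, H'.rate M ≤ H.rate M := by
  rcases le_total (Pattern.edge.rate M) (Pattern.wedge.rate M) with h1 | h1
  · rcases le_total (Pattern.wedge.rate M) (Pattern.fourCycle.rate M) with h2 | h2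
    · exact ⟨.fourCycle, by rintro (_ | _ | _) <;> linarith⟩
    · exact ⟨.wedge, by rintro (_ | _ | _) <;> linarith⟩
  · rcases le_total (Pattern.edge.rate M) (Pattern.fourCycle.rate M) with h2 | h2
    · exact ⟨.fourCycle, by rintro (_ | _ | _) <;> linarith⟩
    · exact ⟨.edge, by rintro (_ | _ | _) <;> linarith⟩

/-- A pattern of maximal rate. It depends on the parameters of the model only. -/
noncomputable def SBM.bestPattern {k : ℕ} (M : SBM k) : Pattern :=
  (Pattern.exists_rate_max M).choose

theorem SBM.rate_le_bestPattern {k : ℕ} (M : SBM k) (H : Pattern) :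
    H.rate M ≤ M.bestPattern.rate M := (Pattern.exists_rate_max M).choose_spec H

theorem le_mul_rate_edge {k n : ℕ} (M : SBM k) {K : ℝ}
    (h : K ≤ n * Pattern.edge.rate M) :
    K ≤ n * |M.meanDegree| ∧ K * M.maxDegree ^ 2 ≤ n * M.meanDegree ^ 2 := by
  have h1 := h.trans (mul_le_mul_of_nonneg_left (min_le_left _ _) n.cast_nonneg)
  have h2 := h.trans (mul_le_mul_of_nonneg_left (min_le_right _ _) n.cast_nonneg)
  refine ⟨h1, ?_⟩
  rcases eq_or_ne M.maxDegree 0 with h0 | h0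
  · rw [h0]
    simp only [ne_eq, OfNat.ofNat_ne_zero, not_false_eq_true, zero_pow, mul_zero]
    positivity
  · rwa [div_pow, ← mul_div_assoc, le_div_iff₀ (by positivity)] at h2

theorem rpow_four_thirds_pow {x : ℝ} (hx : 0 ≤ x) : (x ^ (4 / 3 : ℝ)) ^ 3 = x ^ 4 := by
  rw [← Real.rpow_natCast, ← Real.rpow_mul hx, ← Real.rpow_natCast x 4]
  norm_num

theorem le_mul_rate_wedge {k n : ℕ} (M : SBM k) {K : ℝ} (hK : 1 ≤ K)
    (h : K ≤ n * Pattern.wedge.rate M) :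
    K ^ 3 ≤ (n : ℝ) ^ 3 * M.maxDegree ^ 4 ∧ K * M.maxEntry ^ 2 ≤ n * M.maxDegree ^ 2 := by
  have h1 := h.trans (mul_le_mul_of_nonneg_left (min_le_left _ _) n.cast_nonneg)
  have h2 := h.trans (mul_le_mul_of_nonneg_left (min_le_right _ _) n.cast_nonneg)
  constructor
  · rw [← rpow_four_thirds_pow M.maxDegree_nonneg, ← mul_pow]
    exact pow_le_pow_left₀ (by linarith) h1 3
  · rcases eq_or_ne M.maxEntry 0 with h0 | h0
    · rw [h0]
      simp only [ne_eq, OfNat.ofNat_ne_zero, not_false_eq_true, zero_pow, mul_zero]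
      positivity
    · rwa [div_pow, ← mul_div_assoc, le_div_iff₀ (by positivity)] at h2

/-- If `n` is below the detection threshold of each pattern, then all Fourier coefficients are
small in the sense of `SBM.pow_mul_coeff_le`. -/
theorem SBM.small_of_rate_le {k n : ℕ} (M : SBM k) {K : ℝ} (hK : 1 ≤ K) (hn : 0 < n)
    (h : ∀ H : Pattern, n * H.rate M ≤ K) :
    n * |M.meanDegree| ≤ K ^ 6 ∧ (n : ℝ) ^ 3 * M.maxDegree ^ 4 ≤ K ^ 6 ∧
      n * M.maxEntry ^ 2 ≤ K ^ 6 := by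
  have hn1 : (1 : ℝ) ≤ n := by exact_mod_cast hn
  have hδ := M.maxDegree_nonneg
  have hm := M.abs_meanDegree_le
  have hq : n * M.maxEntry ^ 2 ≤ K := h .fourCycle
  have hδ' : (n : ℝ) ^ 3 * M.maxDegree ^ 4 ≤ K ^ 4 := by
    rcases min_le_iff.1 ((mul_min_of_nonneg _ _ n.cast_nonneg).symm.trans_le (h .wedge)) with
      h1 | h1
    · rw [← rpow_four_thirds_pow hδ, ← mul_pow]
      exact (pow_le_pow_left₀ (by positivity) h1 3).trans (pow_le_pow_right₀ hK (by omega))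
    · have h2 : n * M.maxDegree ^ 2 ≤ K * M.maxEntry ^ 2 := by
        rcases eq_or_ne M.maxEntry 0 with h0 | h0
        · have := M.maxDegree_le_maxEntry
          rw [h0] at this ⊢
          rw [le_antisymm this hδ]
          simp
        · rwa [div_pow, ← mul_div_assoc, div_le_iff₀ (by positivity)] at h1
      calc (n : ℝ) ^ 3 * M.maxDegree ^ 4 ≤ (n : ℝ) ^ 4 * M.maxDegree ^ 4 := by
            gcongr
            omega
        _ = (n * (n * M.maxDegree ^ 2)) ^ 2 := by ring
        _ ≤ (n * (K * M.maxEntry ^ 2)) ^ 2 := by gcongr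
        _ = (K * (n * M.maxEntry ^ 2)) ^ 2 := by ring
        _ ≤ (K * K) ^ 2 := by gcongr
        _ = K ^ 4 := by ring
  refine ⟨?_, hδ'.trans (pow_le_pow_right₀ hK (by omega)), hq.trans (le_self_pow₀ hK (by omega))⟩
  rcases min_le_iff.1 ((mul_min_of_nonneg _ _ n.cast_nonneg).symm.trans_le (h .edge)) with h1 | h1
  · exact h1.trans (le_self_pow₀ hK (by omega))
  · have h2 : n * M.meanDegree ^ 2 ≤ K * M.maxDegree ^ 2 := by
      rcases eq_or_ne M.maxDegree 0 with h0 | h0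
      · rw [h0] at hm ⊢
        rw [abs_nonpos_iff.1 hm]
        simp
      · rwa [div_pow, ← mul_div_assoc, div_le_iff₀ (by positivity)] at h1
    have h4 : (n * |M.meanDegree|) ^ 4 ≤ K ^ 6 := by
      calc (n * |M.meanDegree|) ^ 4 = (n : ℝ) ^ 2 * (n * M.meanDegree ^ 2) ^ 2 := by
            rw [mul_pow, Even.pow_abs (by decide : Even 4)]
            ring
        _ ≤ (n : ℝ) ^ 2 * (K * M.maxDegree ^ 2) ^ 2 := by gcongr
        _ = K ^ 2 * ((n : ℝ) ^ 2 * M.maxDegree ^ 4) := by ring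
        _ ≤ K ^ 2 * ((n : ℝ) ^ 3 * M.maxDegree ^ 4) := by
            gcongr
            omega
        _ ≤ K ^ 2 * K ^ 4 := by gcongr
        _ = K ^ 6 := by ring
    refine (pow_le_pow_iff_left₀ (by positivity) (by positivity) (by omega : 4 ≠ 0)).1
      (h4.trans (le_self_pow₀ (one_le_pow₀ hK) (by omega)))

/-! ### The chosen signed count separates the models -/

theorem Pattern.exists_adj (H : Pattern) (a : Fin H.size) : ∃ b, H.graph.Adj a b := by
  revert a
  cases H with
  | edge => exact (by decide : ∀ a, ∃ b, (SimpleGraph.starGraph (0 : Fin 2)).Adj a b)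
  | wedge => exact (by decide : ∀ a, ∃ b, (SimpleGraph.starGraph (0 : Fin 3)).Adj a b)
  | fourCycle => exact (by decide : ∀ a, ∃ b, (SimpleGraph.cycleGraph 4).Adj a b)

/-- Above the threshold of a pattern, both variances of its signed count are at most a small
multiple of its squared advantage. The power `c ^ 8` covers the loss in `SBM.le_wedgeMean` and
`SBM.le_cycleMean`. -/
theorem SBM.max_var_le_of_rate {k n : ℕ} (M : SBM k) {c K : ℝ} (hc : 0 < c) (hc1 : c ≤ 1)
    (hM : ∀ a, c ≤ M.p a) (hK : 1 ≤ K) (hn : 8 ≤ n) (H : Pattern) (h : K ≤ n * H.rate M) :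
    0 < (expect (M.mass n) (signedCount H.graph n) -
        expect (erdosRenyiMass n) (signedCount H.graph n)) ^ 2 ∧
    max (var (M.mass n) (signedCount H.graph n))
        (var (erdosRenyiMass n) (signedCount H.graph n)) ≤
      pairConst (2 * H.size) * (2 ^ H.size * H.size.factorial) ^ 2 * (1 / (K * c ^ 8)) *
        (expect (M.mass n) (signedCount H.graph n) -
          expect (erdosRenyiMass n) (signedCount H.graph n)) ^ 2 := by
  have hK0 : 0 < K := by linarith
  have hε : 0 ≤ 1 / (K * c ^ 8) := by positivity
  have hδ := M.maxDegree_nonneg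
  have hq := M.maxEntry_nonneg
  have hpow : ∀ i ≤ 8, c ^ 8 ≤ c ^ i := fun i hi => pow_le_pow_of_le_one hc.le hc1 hi
  -- The bounds on pairs are used in the form `K * w * c ^ 8 ≤ (n ^ v * t) ^ 2`.
  have hscale : ∀ w B t : ℝ, K * w ≤ B → c ^ 8 * B ≤ t → w ≤ 1 / (K * c ^ 8) * t := by
    intro w B t h1 h2
    rw [one_div, ← div_eq_inv_mul, le_div_iff₀ (by positivity)]
    calc w * (K * c ^ 8) = c ^ 8 * (K * w) := by ring
      _ ≤ c ^ 8 * B := by gcongr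
      _ ≤ t := h2
  cases H with
  | edge =>
    obtain ⟨h1, h2⟩ := le_mul_rate_edge M h
    have ht0 : M.meanDegree ≠ 0 := by
      intro h0
      rw [h0, abs_zero, mul_zero] at h1
      linarith
    refine M.max_var_signedCount_le (v := 2) (Pattern.exists_adj .edge) (by omega)
      (by omega) hε ht0
      (fun S hS => M.coeff_edge hS) fun S T hS hT hd =>
        hscale _ _ _ (edge_pair_bound M hK h1 h2 hS hT hd) ?_
    exact mul_le_of_le_one_left (sq_nonneg _) (pow_le_one₀ hc.le hc1)
  | wedge =>
    obtain ⟨h1, h2⟩ := le_mul_rate_wedge M hK h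
    have hw := M.le_wedgeMean hM
    have hδ0 : 0 < M.maxDegree := by
      refine hδ.lt_of_ne' fun h0 => ?_
      rw [h0] at h1
      have := one_le_pow₀ (n := 3) hK
      norm_num at h1
      linarith
    have ht0 : 0 < M.wedgeMean := lt_of_lt_of_le (by positivity) hw
    refine M.max_var_signedCount_le (v := 3) (Pattern.exists_adj .wedge) (by omega)
      (by omega) hε ht0.ne'
      (fun S hS => M.coeff_wedge hS) fun S T hS hT hd =>
        hscale _ _ _ (wedge_pair_bound M hK h1 h2 hS hT hd) ?_
    calc c ^ 8 * ((n : ℝ) ^ 6 * M.maxDegree ^ 4)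
        ≤ c ^ 2 * ((n : ℝ) ^ 6 * M.maxDegree ^ 4) := by
          have := hpow 2 (by omega)
          gcongr
      _ = ((n : ℝ) ^ 3 * (c * M.maxDegree ^ 2)) ^ 2 := by ring
      _ ≤ _ := by gcongr
  | fourCycle =>
    have h1 : K ≤ n * M.maxEntry ^ 2 := h
    have hw := M.le_cycleMean hc hM
    have hq0 : 0 < M.maxEntry := by
      refine hq.lt_of_ne' fun h0 => ?_
      rw [h0] at h1
      norm_num at h1
      linarith
    have ht0 : 0 < M.cycleMean := lt_of_lt_of_le (by positivity) hw
    refine M.max_var_signedCount_le (v := 4) (Pattern.exists_adj .fourCycle) (by omega)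
      (by omega) hε ht0.ne'
      (fun S hS => M.coeff_fourCycle hS) fun S T hS hT hd =>
        hscale _ _ _ (fourCycle_pair_bound M hK h1 hS hT hd) ?_
    calc c ^ 8 * ((n : ℝ) ^ 8 * M.maxEntry ^ 8)
        = ((n : ℝ) ^ 4 * (c ^ 4 * M.maxEntry ^ 4)) ^ 2 := by ring
      _ ≤ _ := by gcongr

/-- Once `n` times the rate of `H` exceeds a constant depending on `c` and `C` only, the signed
count of `H` separates the two models by more than `C` standard deviations. -/
theorem exists_const_separates {c : ℝ} (hc : 0 < c) (hc1 : c ≤ 1) (C : ℝ) :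
    ∃ K : ℝ, 1 ≤ K ∧ ∀ {k n : ℕ} (M : SBM k), (∀ a, c ≤ M.p a) → 8 ≤ n → ∀ H : Pattern,
      K ≤ n * H.rate M →
        C * √(max (var (M.mass n) (signedCount H.graph n))
          (var (erdosRenyiMass n) (signedCount H.graph n))) <
        |expect (M.mass n) (signedCount H.graph n) -
          expect (erdosRenyiMass n) (signedCount H.graph n)| := by
  let A : Pattern → ℝ := fun H => pairConst (2 * H.size) * (2 ^ H.size * H.size.factorial) ^ 2
  have hA : ∀ H, 0 < A H := fun H => mul_pos (pairConst_pos _) (by positivity)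
  let K := 1 + (C ^ 2 + 1) * (A .edge + A .wedge + A .fourCycle) / c ^ 8
  have hsum : ∀ H, A H ≤ A .edge + A .wedge + A .fourCycle := by
    have h1 := hA .edge
    have h2 := hA .wedge
    have h3 := hA .fourCycle
    rintro (_ | _ | _) <;> linarith
  have hsum0 := (hA .edge).trans_le (hsum .edge)
  have hK1 : 1 ≤ K := le_add_of_nonneg_right (by positivity)
  have hKA : ∀ H, C ^ 2 * (A H * (1 / (K * c ^ 8))) < 1 := by
    intro H
    have h1 : (C ^ 2 + 1) * (A .edge + A .wedge + A .fourCycle) < K * c ^ 8 := by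
      have : K * c ^ 8 = c ^ 8 + (C ^ 2 + 1) * (A .edge + A .wedge + A .fourCycle) := by
        simp only [K]
        field_simp
      rw [this]
      exact lt_add_of_pos_left _ (by positivity)
    have h0 : 0 < K * c ^ 8 := by positivity
    rw [← mul_assoc, mul_one_div, div_lt_one h0]
    refine lt_of_le_of_lt ?_ h1
    have := hA H
    have := hsum H
    gcongr
    linarith
  refine ⟨K, hK1, fun {k n} M hM hn H h => ?_⟩
  obtain ⟨hpos, hmax⟩ := M.max_var_le_of_rate hc hc1 hM hK1 hn H h
  set d := expect (M.mass n) (signedCount H.graph n) -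
    expect (erdosRenyiMass n) (signedCount H.graph n)
  set V := max (var (M.mass n) (signedCount H.graph n))
    (var (erdosRenyiMass n) (signedCount H.graph n))
  have hV : C ^ 2 * V < d ^ 2 := by
    calc C ^ 2 * V ≤ C ^ 2 * (A H * (1 / (K * c ^ 8)) * d ^ 2) := by gcongr
      _ = C ^ 2 * (A H * (1 / (K * c ^ 8))) * d ^ 2 := by ring
      _ < 1 * d ^ 2 := mul_lt_mul_of_pos_right (hKA H) hpos
      _ = d ^ 2 := one_mul _
  have hd : 0 < |d| := abs_pos.2 fun h => by simp [h] at hpos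
  rcases le_or_gt V 0 with hV0 | hV0
  · rw [Real.sqrt_eq_zero_of_nonpos hV0, mul_zero]
    exact hd
  · refine lt_of_pow_lt_pow_left₀ 2 hd.le ?_
    rw [mul_pow, Real.sq_sqrt hV0.le, sq_abs]
    exact hV

/-- A bound on the Fourier mass bounds the advantage of every low-degree test in standard
deviations. -/
theorem abs_expect_sub_le {k n D : ℕ} (M : SBM k) {f : EdgeConfig n → ℝ} (hf : HasDegreeLE f D)
    {B : ℝ} (hB : ∑ S : Finset (Edge n) with S.card ≤ D ∧ S ≠ ∅, M.coeff S ^ 2 ≤ B) :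
    |expect (M.mass n) f - expect (erdosRenyiMass n) f| ≤
      √B * √(max (var (M.mass n) f) (var (erdosRenyiMass n) f)) := by
  have hB0 : 0 ≤ B := (sum_nonneg fun _ _ => sq_nonneg _).trans hB
  have hv : 0 ≤ var (erdosRenyiMass n) f :=
    sum_nonneg fun G _ => mul_nonneg (erdosRenyiMass_nonneg n G) (sq_nonneg _)
  rw [← Real.sqrt_mul hB0, ← Real.sqrt_sq_eq_abs]
  refine Real.sqrt_le_sqrt ((hf.sq_expect_sub_le M).trans ?_)
  rw [mul_comm]
  exact mul_le_mul hB (le_max_right _ _) hv hB0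

end SBMTesting

theorem mainTheorem6 (c : ℝ) (hc : 0 < c) (k : ℕ → ℕ) (M : ∀ n, SBMTesting.SBM (k n))
    (hM : ∀ n a, c ≤ (M n).p a)
    (htest : ∃ (D : ℕ) (f : ∀ n, SBMTesting.EdgeConfig n → ℝ),
      (∀ n, SBMTesting.HasDegreeLE (f n) D) ∧ SBMTesting.Distinguishes M f) :
    ∃ H : ∀ {m : ℕ}, SBMTesting.SBM m → SBMTesting.Pattern,
      SBMTesting.Distinguishes M fun n => SBMTesting.signedCount (H (M n)).graph n := by
  obtain ⟨D, f, hf, hdist⟩ := htest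
  have hc1 : c ≤ 1 := by
    obtain ⟨a⟩ := (M 0).nonempty
    refine (hM 0 a).trans ?_
    rw [← (M 0).p_sum]
    exact Finset.single_le_sum (fun b _ => (M 0).p_nonneg b) (Finset.mem_univ a)
  refine ⟨fun {m} M' => M'.bestPattern, fun C => ?_⟩
  obtain ⟨K, hK, hsep⟩ := SBMTesting.exists_const_separates hc hc1 C
  filter_upwards [hdist (√(SBMTesting.pairConst (2 * D) * (K ^ 6) ^ (2 * D))),
    Filter.eventually_ge_atTop 8] with n hn hn8
  refine hsep (M n) (hM n) hn8 _ ?_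
  -- Otherwise `n` is below all thresholds and no test of degree at most `D` succeeds.
  by_contra! hlt
  obtain ⟨h1, h2, h3⟩ := (M n).small_of_rate_le hK (by omega) fun H =>
    (mul_le_mul_of_nonneg_left ((M n).rate_le_bestPattern H) n.cast_nonneg).trans hlt.le
  exact absurd hn (not_lt.2 (SBMTesting.abs_expect_sub_le (M n) (hf n)
    ((M n).sum_coeff_sq_le (one_le_pow₀ hK) h1 h2 h3 D)))
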